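/- Let $n\ge 1$, $N=2^n$, and let $\mathcal H_n=\mathbb C^N$ be the $n$-qubit state space with computational basis $|0\rangle,\dots,|N-1\rangle$ (labels read in binary as $n$-qubit basis states). Put $S=(-i\sigma^y)^{\otimes n}$, where $-i\sigma^y=\begin{pmatrix}0&-1\\1&0\end{pmatrix}$, and let $\mathcal C_n(\varphi,\psi)=\varphi^{T}S\,\psi$ be the (complex bilinear) concurrence form on $\mathcal H_n$; the concurrence of a state $\psi$ is $|\mathcal C_n(\psi,\psi)|$. Let $\theta:\mathfrak{su}(N)\to\mathfrak{su}(N)$ be the involution $\theta(X)=S^{-1}\overline{X}S$, let $\mathfrak k$ be its $+1$-eigenspace, and let $K=\exp\mathfrak k=\{e^X : X\in\mathfrak k\}$. For $n$ even, let $E_0$ be the standard entangler $$E_0=\frac1{\sqrt2}\sum_{j=0}^{N/2-1}\Big(|j\rangle\langle 2j|+i\,|j\rangle\langle 2j+1|+\epsilon_j\big(|N-j-1\rangle\langle 2j|-i\,|N-j-1\rangle\langle 2j+1|\big)\Big),\qquad \epsilon_j=(-1)^{\#j},$$ where $\#j$ is the number of ones in the binary expression of $j$. Then: 1. $K\subseteq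 SU(N)$, and $K$ is the symmetry group of $\mathcal C_n$ in $SU(N)$: for $u\in SU(N)$, $$u\in K\iff \mathcal C_n(u\varphi,u\psi)=\mathcal C_n(\varphi,\psi)\ \text{ for all }\varphi,\psi\in\mathcal H_n .$$ In particular $K$ is a subgroup of $SU(N)$. 2. If $n$ is even, then $\mathcal C_n$ is symmetric. The $N$ vectors $E_0|j\rangle$, $0\le j\le N-1$, are unit vectors of concurrence one; $\mathcal C_n$ restricts to the usual dot product on their real span $V_{\mathbb R}$, that is, $\mathcal C_n\big(\sum_j a_jE_0|j\rangle,\sum_j b_jE_0|j\rangle\big)=\sum_j a_jb_j$ for all real $a_j,b_j$; and $uV_{\mathbb R}\subseteq V_{\mathbb R}$ for every $u\in K$. 3. If $n$ is odd, then $\mathcal C_n$ is antisymmetric and nondegenerate. 4. If $n$ is even, then $E_0$ is unitary and $u\mapsto E_0^\dagger uE_0$ is an isomorphism of topological groups from $K$ onto $SO(N)$ (real orthogonal $N\times N$ matrices of determinant one). If $n$ is odd, then $K$ is isomorphic, as a topological group, to the compact symplectic group $Sp(N/2)=\{V\in SU(N) : V^{T}\Sigma V=\Sigma\}$, where $\Sigma=(-i\sigma^y)\otimes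 \mathbf 1_{N/2}$. -/

import Mathlib

open scoped Matrix

namespace Concurrence

attribute [local instance] LieRing.ofAssociativeRing

/-- The space `H_n` of `n`-qubit states, in the coordinates of the computational basis
`|0⟩, …, |2 ^ n - 1⟩`. -/
abbrev State (n : ℕ) : Type := Fin (2 ^ n) → ℂ

/-- Complex matrices of size `N × N`, `N = 2 ^ n`. -/
abbrev Mat (n : ℕ) : Type := Matrix (Fin (2 ^ n)) (Fin (2 ^ n)) ℂ

/-- The value of the `i`-th qubit (`i = 0` is the leftmost, most significant one) in the
computational basis state `|j⟩`. -/
def qubit {n : ℕ} (j : Fin (2 ^ n)) (i : Fin n) : Fin 2 :=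
  finFunctionFinEquiv.symm j i.rev

/-- The number `#j` of ones in the binary expression of `j`. -/
def numOnes {n : ℕ} (j : Fin (2 ^ n)) : ℕ := ∑ i : Fin n, ((qubit j i : Fin 2) : ℕ)

/-- The Pauli matrix `σ^y`. -/
def pauliY : Matrix (Fin 2) (Fin 2) ℂ := !![0, -Complex.I; Complex.I, 0]

/-- The `n`-fold tensor power of a one-qubit operator, in the computational basis. -/
def tensorPow (n : ℕ) (A : Matrix (Fin 2) (Fin 2) ℂ) : Mat n :=
  Matrix.of fun j k => ∏ i, A (qubit j i) (qubit k i)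

/-- `S = (-i σ^y)^{⊗ n}`. -/
noncomputable def S (n : ℕ) : Mat n := tensorPow n ((-Complex.I) • pauliY)

/-- The concurrence form `C_n(φ, ψ) = φᵀ S ψ`, a complex bilinear form. -/
noncomputable def form (n : ℕ) : LinearMap.BilinForm ℂ (State n) := Matrix.toBilin' (S n)

theorem form_apply (n : ℕ) (φ ψ : State n) : form n φ ψ = φ ⬝ᵥ (S n *ᵥ ψ) :=
  Matrix.toBilin'_apply' _ _ _

/-- The concurrence of a state. -/
noncomputable def concurrence (n : ℕ) (ψ : State n) : ℝ := ‖form n ψ ψ‖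

/-! ### The Lie algebra, the involution and the group `K` -/

/-- The real Lie algebra `su(2 ^ n)` of traceless skew-Hermitian matrices. -/
def su (n : ℕ) : LieSubalgebra ℝ (Mat n) where
  carrier := {X | Xᴴ = -X ∧ X.trace = 0}
  zero_mem' := by simp
  add_mem' := by
    rintro X Y ⟨hX, tX⟩ ⟨hY, tY⟩
    refine ⟨?_, ?_⟩
    · rw [Matrix.conjTranspose_add, hX, hY]; abel
    · rw [Matrix.trace_add, tX, tY, add_zero]
  smul_mem' := by
    rintro c X ⟨hX, tX⟩
    refine ⟨?_, ?_⟩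
    · rw [Matrix.conjTranspose_smul, hX, star_trivial, smul_neg]
    · rw [Matrix.trace_smul, tX, smul_zero]
  lie_mem' := by
    rintro X Y ⟨hX, tX⟩ ⟨hY, tY⟩
    refine ⟨?_, ?_⟩
    · simp [Ring.lie_def, Matrix.conjTranspose_sub, Matrix.conjTranspose_mul, hX, hY]
    · simp [Ring.lie_def, Matrix.trace_sub, Matrix.trace_mul_comm X Y]

/-- The entrywise complex conjugate of a matrix. -/
noncomputable def conjMat {n : ℕ} (X : Mat n) : Mat n := X.map (starRingEnd ℂ)

theorem conjMat_mul {n : ℕ} (X Y : Mat n) : conjMat (X * Y) = conjMat X * conjMat Y :=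
  Matrix.map_mul

theorem conjMat_conjMat {n : ℕ} (X : Mat n) : conjMat (conjMat X) = X := by
  ext i j; simp [conjMat]

theorem negI_pauliY : (-Complex.I) • pauliY = !![0, -1; 1, 0] := by
  ext i j; fin_cases i <;> fin_cases j <;> simp [pauliY]

theorem tensorPow_mul (n : ℕ) (A B : Matrix (Fin 2) (Fin 2) ℂ) :
    tensorPow n A * tensorPow n B = tensorPow n (A * B) := by
  ext j k
  simp only [tensorPow, Matrix.mul_apply, Matrix.of_apply, ← Finset.prod_mul_distrib]
  rw [Finset.prod_univ_sum, Fintype.piFinset_univ]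
  refine Fintype.sum_equiv (finFunctionFinEquiv.symm.trans (Equiv.arrowCongr Fin.revPerm
    (Equiv.refl _))) _ _ fun x => ?_
  simp [qubit, Equiv.arrowCongr]

theorem tensorPow_one (n : ℕ) : tensorPow n 1 = 1 := by
  ext j k
  by_cases h : j = k
  · subst h; simp [tensorPow]
  · rw [Matrix.one_apply_ne h]
    obtain ⟨i, hi⟩ : ∃ i, qubit j i ≠ qubit k i := by
      by_contra! hh
      apply h
      apply finFunctionFinEquiv.symm.injective
      funext i
      simpa [qubit] using hh i.rev
    exact Finset.prod_eq_zero (Finset.mem_univ i) (Matrix.one_apply_ne hi)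

theorem conjMat_S (n : ℕ) : conjMat (S n) = S n := by
  ext j k
  simp only [S, conjMat, tensorPow, negI_pauliY, Matrix.map_apply, Matrix.of_apply, map_prod]
  refine Finset.prod_congr rfl fun i _ => ?_
  generalize qubit j i = a
  generalize qubit k i = b
  fin_cases a <;> fin_cases b <;> simp

theorem conjTranspose_S_mul_S (n : ℕ) : (S n)ᴴ * S n = 1 := by
  have h : (S n)ᴴ = tensorPow n !![0, 1; -1, 0] := by
    ext j k
    simp only [S, tensorPow, negI_pauliY, Matrix.conjTranspose_apply, Matrix.of_apply]
    rw [← starRingEnd_apply, map_prod]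
    refine Finset.prod_congr rfl fun i _ => ?_
    generalize qubit j i = a
    generalize qubit k i = b
    fin_cases a <;> fin_cases b <;> simp
  rw [h, S, negI_pauliY, tensorPow_mul, ← tensorPow_one n]
  congr 1
  ext i j; fin_cases i <;> fin_cases j <;> simp

theorem S_inv (n : ℕ) : (S n)⁻¹ = (S n)ᴴ := Matrix.inv_eq_left_inv (conjTranspose_S_mul_S n)

theorem S_mul_inv (n : ℕ) : S n * (S n)⁻¹ = 1 := by
  rw [S_inv]; exact mul_eq_one_comm.mp (conjTranspose_S_mul_S n)

theorem S_mul_S (n : ℕ) : S n * S n = (-1 : ℂ) ^ n • (1 : Mat n) := by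
  rw [S, negI_pauliY, tensorPow_mul]
  have h : (!![0, -1; 1, 0] * !![0, -1; 1, 0] : Matrix (Fin 2) (Fin 2) ℂ) = (-1 : ℂ) • 1 := by
    ext i j; fin_cases i <;> fin_cases j <;> simp
  rw [h, ← tensorPow_one n]
  ext j k
  simp [tensorPow, -neg_smul, -Matrix.smul_apply, Matrix.smul_apply,
    Finset.prod_neg]

/-- `X ↦ S⁻¹ X̄ S` on all matrices. -/
noncomputable def thetaMat {n : ℕ} (X : Mat n) : Mat n := (S n)⁻¹ * conjMat X * S n

theorem thetaMat_mul {n : ℕ} (X Y : Mat n) : thetaMat (X * Y) = thetaMat X * thetaMat Y := by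
  simp only [thetaMat, conjMat_mul, Matrix.mul_assoc]
  rw [← Matrix.mul_assoc (S n) (S n)⁻¹, S_mul_inv, Matrix.one_mul]

theorem thetaMat_sub {n : ℕ} (X Y : Mat n) : thetaMat (X - Y) = thetaMat X - thetaMat Y := by
  have : conjMat (X - Y) = conjMat X - conjMat Y := by ext i j; simp [conjMat]
  rw [thetaMat, this, Matrix.mul_sub, Matrix.sub_mul]; rfl

theorem thetaMat_add {n : ℕ} (X Y : Mat n) : thetaMat (X + Y) = thetaMat X + thetaMat Y := by
  have : conjMat (X + Y) = conjMat X + conjMat Y := by ext i j; simp [conjMat]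
  rw [thetaMat, this, Matrix.mul_add, Matrix.add_mul]; rfl

theorem thetaMat_smul {n : ℕ} (c : ℝ) (X : Mat n) : thetaMat (c • X) = c • thetaMat X := by
  have : conjMat (c • X) = c • conjMat X := by ext i j; simp [conjMat]
  rw [thetaMat, this, Matrix.mul_smul, Matrix.smul_mul]; rfl

theorem thetaMat_mem {n : ℕ} {X : Mat n} (hX : X ∈ su n) : thetaMat X ∈ su n := by
  obtain ⟨h, t⟩ := hX
  refine ⟨?_, ?_⟩
  · have : (conjMat X)ᴴ = -conjMat X := by
      have h' : (conjMat X)ᴴ = conjMat Xᴴ := by ext i j; simp [conjMat]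
      rw [h', h]; ext i j; simp [conjMat]
    simp only [thetaMat, S_inv, Matrix.conjTranspose_mul, Matrix.conjTranspose_conjTranspose, this]
    simp [Matrix.mul_assoc]
  · rw [thetaMat, Matrix.mul_assoc, Matrix.trace_mul_comm, Matrix.mul_assoc, S_mul_inv,
      Matrix.mul_one]
    have : (conjMat X).trace = starRingEnd ℂ X.trace := by simp [conjMat, Matrix.trace]
    rw [this, t, map_zero]

/-- The map `θ : su(2 ^ n) → su(2 ^ n)`, `θ(X) = S⁻¹ X̄ S`. -/
noncomputable def theta (n : ℕ) : su n →ₗ⁅ℝ⁆ su n where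
  toFun X := ⟨thetaMat (X : Mat n), thetaMat_mem X.2⟩
  map_add' X Y := Subtype.ext (thetaMat_add _ _)
  map_smul' c X := Subtype.ext (thetaMat_smul _ _)
  map_lie' {X Y} := Subtype.ext <| by
    simp only [LieSubalgebra.coe_bracket, Ring.lie_def, thetaMat_sub, thetaMat_mul]

theorem coe_theta {n : ℕ} (X : su n) :
    (theta n X : Mat n) = (S n)⁻¹ * (X : Mat n).map (starRingEnd ℂ) * S n := rfl

/-- `θ` is an involution. -/
theorem theta_theta {n : ℕ} (X : su n) : theta n (theta n X) = X := by
  apply Subtype.ext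
  change thetaMat (thetaMat (X : Mat n)) = X
  have h1 : conjMat (S n)⁻¹ * S n = conjMat ((S n)⁻¹ * S n) := by rw [conjMat_mul, conjMat_S]
  have h2 : (S n)⁻¹ * S n = 1 := by rw [S_inv]; exact conjTranspose_S_mul_S n
  have h3 : conjMat (1 : Mat n) = 1 := by
    ext i j; by_cases h : i = j <;> simp [conjMat, Matrix.one_apply, h]
  have h4 : conjMat (S n)⁻¹ = (S n)⁻¹ := by
    rw [h2, h3] at h1
    exact (Matrix.inv_eq_left_inv h1).symm
  have h5 : (S n)⁻¹ * (S n)⁻¹ = (-1 : ℂ) ^ n • (1 : Mat n) := by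
    rw [← Matrix.mul_inv_rev, S_mul_S]
    refine Matrix.inv_eq_left_inv ?_
    rw [Matrix.smul_mul, Matrix.one_mul, smul_smul, ← mul_pow]; simp
  simp only [thetaMat, conjMat_mul, conjMat_conjMat, conjMat_S, h4]
  calc (S n)⁻¹ * ((S n)⁻¹ * (X : Mat n) * S n) * S n
      = ((S n)⁻¹ * (S n)⁻¹) * (X : Mat n) * (S n * S n) := by simp only [Matrix.mul_assoc]
    _ = X := by
      rw [h5, S_mul_S, Matrix.smul_mul, Matrix.one_mul, Matrix.mul_smul, Matrix.mul_one, smul_smul,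
        ← mul_pow]
      simp

/-- `𝔨`, the `+1`-eigenspace of `θ`. -/
noncomputable def kAlg (n : ℕ) : Submodule ℝ (su n) :=
  Module.End.eigenspace (theta n : Module.End ℝ (su n)) 1

/-- `K = exp 𝔨`, the set of matrix exponentials of elements of `𝔨`. -/
noncomputable def K (n : ℕ) : Set (Mat n) :=
  {u | ∃ X ∈ kAlg n, NormedSpace.exp (X : Mat n) = u}

/-! ### The standard entangler -/

/-- `|a⟩⟨b|` for natural numbers `a`, `b` less than `2 ^ n`. -/
def ketBra (n a b : ℕ) : Mat n :=
  Matrix.of fun r c => if (r : ℕ) = a ∧ (c : ℕ) = b then 1 else 0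

/-- The standard entangler (for `n ≥ 2` even): with `N = 2 ^ n` and `ε_j = (-1) ^ #j`,
`E₀ = 2 ^ (-1/2) ∑_{0 ≤ j < N / 2}
  (|j⟩⟨2j| + i |j⟩⟨2j+1| + ε_j (|N-j-1⟩⟨2j| - i |N-j-1⟩⟨2j+1|))`. -/
noncomputable def E₀ (n : ℕ) : Mat n :=
  ((1 / Real.sqrt 2 : ℝ) : ℂ) • ∑ j ∈ Finset.univ.filter (fun j : Fin (2 ^ n) => (j : ℕ) < 2 ^ n / 2),
    (ketBra n (j : ℕ) (2 * (j : ℕ)) + Complex.I • ketBra n (j : ℕ) (2 * (j : ℕ) + 1)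
      + (-1 : ℂ) ^ numOnes j • (ketBra n (2 ^ n - (j : ℕ) - 1) (2 * (j : ℕ))
        - Complex.I • ketBra n (2 ^ n - (j : ℕ) - 1) (2 * (j : ℕ) + 1)))

/-- The image `E₀ |j⟩` of the `j`-th computational basis state. -/
noncomputable def entangled (n : ℕ) (j : Fin (2 ^ n)) : State n := E₀ n *ᵥ Pi.single j 1

/-- The real subspace of `H_n` spanned by the states `E₀ |j⟩`, `0 ≤ j ≤ 2 ^ n - 1`. -/
noncomputable def realSpan (n : ℕ) : Submodule ℝ (State n) :=
  Submodule.span ℝ (Set.range (entangled n))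

/-! ### The compact symplectic group -/

/-- The compact group `Sp(m) = {V ∈ SU(2m) | Vᵀ Σ V = Σ}`, `Σ = (-i σ^y) ⊗ 1_m`; the matrix `Σ` is
the block matrix `J = (0, -1; 1, 0)`. -/
def compactSp (m : ℕ) : Subgroup (Matrix.specialUnitaryGroup (Fin m ⊕ Fin m) ℂ) where
  carrier := {V | (V : Matrix (Fin m ⊕ Fin m) (Fin m ⊕ Fin m) ℂ)ᵀ * Matrix.J (Fin m) ℂ *
    (V : Matrix (Fin m ⊕ Fin m) (Fin m ⊕ Fin m) ℂ) = Matrix.J (Fin m) ℂ}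
  one_mem' := by simp
  mul_mem' := by
    intro V W hV hW
    simp only [Set.mem_ofPred_eq, Submonoid.coe_mul, Matrix.transpose_mul] at hV hW ⊢
    calc _ = (W.1)ᵀ * ((V.1)ᵀ * Matrix.J (Fin m) ℂ * V.1) * W.1 := by
          simp only [Matrix.mul_assoc]
      _ = _ := by rw [hV, hW]
  inv_mem' := by
    intro V hV
    simp only [Set.mem_ofPred_eq] at hV ⊢
    have h1 : V.1 * (V⁻¹).1 = 1 := by
      rw [← Submonoid.coe_mul, mul_inv_cancel, Submonoid.coe_one]
    have h2 : ((V⁻¹).1)ᵀ * (V.1)ᵀ = 1 := by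
      rw [← Matrix.transpose_mul, h1, Matrix.transpose_one]
    calc _ = ((V⁻¹).1)ᵀ * ((V.1)ᵀ * Matrix.J (Fin m) ℂ * V.1) * (V⁻¹).1 := by rw [hV]
      _ = (((V⁻¹).1)ᵀ * (V.1)ᵀ) * Matrix.J (Fin m) ℂ * (V.1 * (V⁻¹).1) := by
          simp only [Matrix.mul_assoc]
      _ = _ := by rw [h1, h2, Matrix.one_mul, Matrix.mul_one]

end Concurrence

/-!
The proof rests on one description of `K`: it consists of the `u ∈ SU(N)` with `uᵀ S u = S`
(`mem_K_iff`). Everything else is linear algebra with this equation.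

For unitary `u`, the equation `uᵀ S u = S` says that `u` is fixed by `X ↦ S⁻¹ X̄ S`, in other words
that `u` commutes with the antiunitary map `v ↦ S⁻¹ v̄`. As the matrix exponential commutes with
`X ↦ S⁻¹ X̄ S`, the exponential of an element of `𝔨` is a symmetry. Taking determinants in
`uᵀ S u = S` gives `det u = ±1`, so `det (exp X) = det (exp (X / 2)) ^ 2 = 1` (`det_exp_eq_one`).

Conversely, a symmetry `u` of determinant one has a logarithm in `𝔨` (`exists_exp_eq`). If `u ≠ 1`,
there is an eigenvector `v` with eigenvalue `μ ≠ 1` and `vᵀ S v = 0`: this is automatic when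
`μ ≠ ±1`, and if `-1` is the only eigenvalue other than `1`, its eigenspace has dimension at least
two, because `det u = 1`, and so contains an isotropic vector (`exists_isotropic_eigenvector`).
Let `p` be the projection onto the line of `v` and `q = S⁻¹ p̄ S`. Isotropy of `v` means `p q = 0`,
and `Y = i arg(μ) (p - q)` lies in `𝔨`. The symmetry `u exp(-Y)` fixes the range of `p` and all
vectors fixed by `u`, so induction on the space of fixed vectors applies to it. Choosing logarithms
which annihilate the fixed vectors makes the successive summands commute.

For `n` even, a computation gives `E₀ᵀ S E₀ = 1` and `E₀ᴴ E₀ = 1`; hence conjugation with `E₀` turns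
`uᵀ S u = S` into `MᵀM = 1`, and a unitary matrix `M` with `MᵀM = 1` is real. For `n` odd, the
vectors `|i⟩` and `S|i⟩` with `i < N / 2` form a real orthonormal basis in which `S` becomes the
standard symplectic matrix.
-/

open scoped Matrix

namespace Concurrence

open Matrix NormedSpace

variable {n : ℕ}

/-! ### The matrix `S` and the conjugation `X ↦ S⁻¹ X̄ S` -/

theorem transpose_S_eq_conjTranspose (n : ℕ) : (S n)ᵀ = (S n)ᴴ := by
  conv_lhs => rw [← conjMat_S n]
  rfl

theorem transpose_S_mul_S (n : ℕ) : (S n)ᵀ * S n = 1 := by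
  rw [transpose_S_eq_conjTranspose, conjTranspose_S_mul_S]

theorem S_mul_transpose_S (n : ℕ) : S n * (S n)ᵀ = 1 :=
  mul_eq_one_comm.mp (transpose_S_mul_S n)

theorem transpose_S (n : ℕ) : (S n)ᵀ = (-1 : ℂ) ^ n • S n := by
  calc (S n)ᵀ = ((-1 : ℂ) ^ n * (-1) ^ n) • (S n)ᵀ := by rw [← mul_pow]; simp
    _ = (-1 : ℂ) ^ n • ((S n)ᵀ * (S n * S n)) := by
      rw [S_mul_S, Matrix.mul_smul, Matrix.mul_one, smul_smul]
    _ = _ := by rw [← Matrix.mul_assoc, transpose_S_mul_S, Matrix.one_mul]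

theorem thetaMat_eq (X : Mat n) : thetaMat X = (S n)ᵀ * conjMat X * S n := by
  rw [thetaMat, S_inv, transpose_S_eq_conjTranspose]

theorem conjMat_eq (X : Mat n) : conjMat X = Xᴴᵀ := rfl

theorem conjMat_transpose_S (n : ℕ) : conjMat (S n)ᵀ = (S n)ᵀ := by
  conv_rhs => rw [← conjMat_S n]
  rfl

theorem thetaMat_complex_smul (c : ℂ) (X : Mat n) : thetaMat (c • X) = star c • thetaMat X := by
  rw [thetaMat_eq, thetaMat_eq, conjMat_eq, conjMat_eq]
  simp

theorem thetaMat_thetaMat (X : Mat n) : thetaMat (thetaMat X) = X := by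
  simp only [thetaMat_eq, conjMat_mul, conjMat_S, conjMat_conjMat, conjMat_transpose_S]
  calc (S n)ᵀ * ((S n)ᵀ * X * S n) * S n = ((S n)ᵀ * (S n)ᵀ) * X * (S n * S n) := by
        simp only [Matrix.mul_assoc]
    _ = X := by
      rw [← transpose_mul, S_mul_S, transpose_smul, transpose_one, Matrix.smul_mul, Matrix.one_mul,
        Matrix.mul_smul, Matrix.mul_one, smul_smul, ← mul_pow]
      simp

theorem thetaMat_conjTranspose (X : Mat n) : thetaMat Xᴴ = (thetaMat X)ᴴ := by
  have h : Xᴴᵀᴴ = Xᵀ := by ext i j; simp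
  simp only [thetaMat_eq, conjTranspose_mul, transpose_S_eq_conjTranspose, conjMat_eq,
    conjTranspose_conjTranspose, h, Matrix.mul_assoc]

theorem thetaMat_exp (X : Mat n) : thetaMat (exp X) = exp (thetaMat X) := by
  have hS : IsUnit (S n) := .of_mul_eq_one_right _ (transpose_S_mul_S n)
  rw [thetaMat, thetaMat, exp_conj' _ _ hS, conjMat_eq, conjMat_eq, exp_transpose,
    exp_conjTranspose]

/-- A unitary matrix is fixed by `X ↦ S⁻¹ X̄ S` precisely when it preserves the bilinear form of
`S`. -/
theorem thetaMat_eq_self_iff {u : Mat n} (hu : uᴴ * u = 1) :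
    thetaMat u = u ↔ uᵀ * S n * u = S n := by
  have hu' : uᵀ * conjMat u = 1 := by
    rw [conjMat_eq, ← transpose_mul, hu, transpose_one]
  have hu'' : conjMat u * uᵀ = 1 := mul_eq_one_comm.mp hu'
  rw [thetaMat_eq]
  constructor
  · intro h
    calc uᵀ * S n * u = uᵀ * S n * ((S n)ᵀ * conjMat u * S n) := by rw [h]
      _ = uᵀ * (S n * (S n)ᵀ) * conjMat u * S n := by simp only [Matrix.mul_assoc]
      _ = S n := by rw [S_mul_transpose_S, Matrix.mul_one, hu', Matrix.one_mul]
  · intro h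
    calc (S n)ᵀ * conjMat u * S n = (S n)ᵀ * conjMat u * (uᵀ * S n * u) := by rw [h]
      _ = (S n)ᵀ * (conjMat u * uᵀ) * S n * u := by simp only [Matrix.mul_assoc]
      _ = u := by rw [hu'', Matrix.mul_one, transpose_S_mul_S, Matrix.one_mul]

/-! ### Exponentials of idempotents -/

theorem exp_smul_of_isIdempotentElem {ι : Type*} [Fintype ι] [DecidableEq ι]
    {p : Matrix ι ι ℂ} (hp : p * p = p) (c : ℂ) :
    exp (c • p) = 1 + (Complex.exp c - 1) • p := by
  have h1 : HasSum (fun k : ℕ => (c ^ k / (k.factorial : ℂ)) • p) (Complex.exp c • p) := by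
    rw [Complex.exp_eq_exp_ℂ]
    exact (expSeries_div_hasSum_exp c).smul_const p
  have h2 : HasSum (fun k : ℕ => if k = 0 then 1 - p else 0) (1 - p) := by
    simpa using hasSum_ite_eq (0 : ℕ) (1 - p)
  have h3 : (fun k : ℕ => ((k.factorial : ℂ)⁻¹) • (c • p) ^ k) =
      fun k => (c ^ k / (k.factorial : ℂ)) • p + if k = 0 then 1 - p else 0 := by
    funext k
    rcases k with _ | k
    · simp
    · have : p ^ (k + 1) = p := IsIdempotentElem.pow_succ_eq k hp
      rw [smul_pow, this, smul_smul]
      simp [div_eq_inv_mul]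
  rw [exp_eq_tsum ℂ]
  beta_reduce
  rw [h3, (h1.add h2).tsum_eq, sub_smul, one_smul]
  abel

/-- The exponential of `c (p - q)` for orthogonal idempotents `p` and `q`. -/
theorem exp_smul_sub_of_orthogonal {ι : Type*} [Fintype ι] [DecidableEq ι]
    {p q : Matrix ι ι ℂ} (hp : p * p = p) (hq : q * q = q) (hpq : p * q = 0) (hqp : q * p = 0)
    (c : ℂ) :
    exp (c • (p - q)) = 1 + (Complex.exp c - 1) • p + (Complex.exp (-c) - 1) • q := by
  have h : c • (p - q) = c • p + (-c) • q := by rw [smul_sub, neg_smul, sub_eq_add_neg]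
  have hc : Commute (c • p) ((-c) • q) := by
    rw [commute_iff_eq]; simp [hpq, hqp]
  rw [h, exp_add_of_commute _ _ hc, exp_smul_of_isIdempotentElem hp,
    exp_smul_of_isIdempotentElem hq]
  simp [mul_add, add_mul, hpq]

/-! ### Eigenvectors of unitary matrices -/

/-- A unitary matrix whose only eigenvalue is `1` is the identity, by the spectral theorem for normal
elements. -/
theorem exists_eigenvector_ne_one {ι : Type*} [Fintype ι] [DecidableEq ι] {u : Matrix ι ι ℂ}
    (hu : uᴴ * u = 1) (h1 : u ≠ 1) :
    ∃ μ : ℂ, μ ≠ 1 ∧ ∃ v : ι → ℂ, v ≠ 0 ∧ u *ᵥ v = μ • v := by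
  open scoped Matrix.Norms.L2Operator in
  by_contra! hno
  refine h1 (CFC.eq_one_of_spectrum_subset_one (R := ℂ) u ?_ ?_)
  · intro μ hμ
    rw [← spectrum_toLin', ← Module.End.hasEigenvalue_iff_mem_spectrum] at hμ
    obtain ⟨v, hv⟩ := hμ.exists_hasEigenvector
    by_contra hμ1
    exact hno μ hμ1 v hv.2 (by simpa using hv.apply_eq_smul)
  · rw [isStarNormal_iff, commute_iff_eq, star_eq_conjTranspose, hu, mul_eq_one_comm.mp hu]

/-- The matrix of the orthogonal projection onto the line spanned by `v` (zero if `v = 0`). -/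
noncomputable def lineProj {ι : Type*} [Fintype ι] (v : ι → ℂ) : Matrix ι ι ℂ :=
  (star v ⬝ᵥ v)⁻¹ • vecMulVec v (star v)

section lineProj

variable {ι : Type*} [Fintype ι] {v : ι → ℂ}

theorem star_dotProduct_self_ne_zero (hv : v ≠ 0) : star v ⬝ᵥ v ≠ 0 := by
  open ComplexOrder in
  simpa using dotProduct_star_self_eq_zero.not.mpr hv

theorem lineProj_mulVec (v x : ι → ℂ) :
    lineProj v *ᵥ x = ((star v ⬝ᵥ v)⁻¹ * (star v ⬝ᵥ x)) • v := by
  rw [lineProj, smul_mulVec, vecMulVec_mulVec, op_smul_eq_smul, smul_smul]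

theorem lineProj_mulVec_self (hv : v ≠ 0) : lineProj v *ᵥ v = v := by
  rw [lineProj_mulVec, inv_mul_cancel₀ (star_dotProduct_self_ne_zero hv), one_smul]

theorem lineProj_mul_self (hv : v ≠ 0) : lineProj v * lineProj v = lineProj v := by
  conv_lhs => enter [2]; rw [lineProj]
  rw [Matrix.mul_smul, mul_vecMulVec, lineProj_mulVec_self hv, lineProj]

theorem conjTranspose_lineProj (v : ι → ℂ) : (lineProj v)ᴴ = lineProj v := by
  rw [lineProj, conjTranspose_smul, conjTranspose_vecMulVec, star_star, star_inv₀, ← star_dotProduct]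

theorem mul_lineProj_of_mulVec_eq {u : Matrix ι ι ℂ} {μ : ℂ} (h : u *ᵥ v = μ • v) :
    u * lineProj v = μ • lineProj v := by
  rw [lineProj, Matrix.mul_smul, mul_vecMulVec, h, smul_vecMulVec, smul_comm]

theorem lineProj_ne_zero (hv : v ≠ 0) : lineProj v ≠ 0 := by
  intro h
  have := lineProj_mulVec_self hv
  rw [h, zero_mulVec] at this
  exact hv this.symm

theorem det_one_sub_two_smul_lineProj [DecidableEq ι] (hv : v ≠ 0) :
    (1 - (2 : ℂ) • lineProj v).det = -1 := by
  have h : (1 - (2 : ℂ) • lineProj v) = 1 + replicateCol Unit ((-2 * (star v ⬝ᵥ v)⁻¹) • v) *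
      replicateRow Unit (star v) := by
    rw [← vecMulVec_eq, smul_vecMulVec, lineProj, smul_smul, neg_mul, neg_smul, sub_eq_add_neg]
  rw [h, det_one_add_replicateCol_mul_replicateRow, dotProduct_smul, smul_eq_mul, mul_assoc,
    inv_mul_cancel₀ (star_dotProduct_self_ne_zero hv)]
  norm_num

end lineProj

/-- If a unitary matrix satisfies `u p = μ p` with `p` Hermitian, then also `p u = μ p`. -/
theorem mul_eq_smul_of_eq_smul {ι : Type*} [Fintype ι] [DecidableEq ι] {u p : Matrix ι ι ℂ}
    {μ : ℂ} (hu : uᴴ * u = 1) (hp : pᴴ = p) (hμ : star μ * μ = 1) (h : u * p = μ • p) :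
    p * u = μ • p := by
  have h' : p * uᴴ = star μ • p := by
    have := congrArg conjTranspose h
    rwa [conjTranspose_mul, conjTranspose_smul, hp] at this
  have : μ • (p * uᴴ * u) = μ • star μ • p * u := by rw [h']; simp
  rw [Matrix.mul_assoc, hu, Matrix.mul_one, smul_smul, mul_comm μ, hμ, one_smul] at this
  exact this.symm

theorem star_mul_self_eq_one_of_eq_smul {ι : Type*} [Fintype ι] [DecidableEq ι]
    {u p : Matrix ι ι ℂ} {μ : ℂ} (hu : uᴴ * u = 1) (hp0 : p ≠ 0) (h : u * p = μ • p) :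
    star μ * μ = 1 := by
  have h2 : pᴴ * p = (star μ * μ) • (pᴴ * p) := by
    calc pᴴ * p = pᴴ * (uᴴ * u) * p := by rw [hu, Matrix.mul_one]
      _ = (u * p)ᴴ * (u * p) := by rw [conjTranspose_mul]; simp only [Matrix.mul_assoc]
      _ = _ := by
        rw [h, conjTranspose_smul, Matrix.smul_mul, Matrix.mul_smul, smul_smul]
  open ComplexOrder in
  have h0 : pᴴ * p ≠ 0 := fun h => hp0 (conjTranspose_mul_self_eq_zero.mp h)
  have : (star μ * μ - 1) • (pᴴ * p) = 0 := by rw [sub_smul, one_smul, ← h2, sub_self]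
  rcases smul_eq_zero.mp this with h | h
  · exact sub_eq_zero.mp h
  · exact absurd h h0

/-! ### Logarithms of symmetries of the bilinear form -/

/-- For isotropic `v`, the lines spanned by `v` and `S⁻¹ v̄` are orthogonal. -/
theorem lineProj_mul_thetaMat_lineProj {v : State n} (hv : v ⬝ᵥ (S n *ᵥ v) = 0) :
    lineProj v * thetaMat (lineProj v) = 0 := by
  have h : star v ⬝ᵥ ((S n)ᵀ *ᵥ star v) = 0 := by
    have h1 := congrArg star hv
    rw [← star_dotProduct_star, star_mulVec, ← transpose_S_eq_conjTranspose, star_zero,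
      vecMul_transpose] at h1
    rw [mulVec_transpose, dotProduct_comm, ← dotProduct_mulVec]
    exact (dotProduct_comm _ _).trans h1
  have h2 : conjMat (lineProj v) = (star v ⬝ᵥ v)⁻¹ • vecMulVec (star v) v := by
    rw [conjMat_eq, conjTranspose_lineProj, lineProj, transpose_smul, transpose_vecMulVec]
  have h3 : vecMulVec v (star v) * ((S n)ᵀ * vecMulVec (star v) v * S n) = 0 := by
    rw [mul_vecMulVec, vecMulVec_mul _ v (S n), vecMulVec_mul_vecMulVec, h, zero_smul, vecMulVec_zero]
  rw [thetaMat_eq, h2, lineProj, Matrix.mul_smul, Matrix.smul_mul, Matrix.smul_mul,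
    Matrix.mul_smul, h3, smul_zero, smul_zero]

theorem dotProduct_S_mulVec_of_eigenvector {u : Mat n} (hS : uᵀ * S n * u = S n) {v : State n}
    {μ : ℂ} (h : u *ᵥ v = μ • v) :
    v ⬝ᵥ (S n *ᵥ v) = μ ^ 2 * (v ⬝ᵥ (S n *ᵥ v)) := by
  calc v ⬝ᵥ (S n *ᵥ v) = (u *ᵥ v) ⬝ᵥ (S n *ᵥ (u *ᵥ v)) := by
        conv_lhs => rw [← hS]
        rw [← mulVec_mulVec, ← mulVec_mulVec, dotProduct_mulVec, vecMul_transpose]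
    _ = _ := by
      rw [h, mulVec_smul, dotProduct_smul, smul_dotProduct, smul_eq_mul, smul_eq_mul]; ring

/-- A nontrivial unitary matrix of determinant one which preserves the bilinear form of `S` has an
isotropic eigenvector with eigenvalue different from `1`. Eigenvectors for eigenvalues other than
`±1` are always isotropic. If `-1` is the only other eigenvalue, its eigenspace has dimension at
least two, since a reflection has determinant `-1`, and hence contains an isotropic vector. -/
theorem exists_isotropic_eigenvector {u : Mat n} (hu : uᴴ * u = 1) (hS : uᵀ * S n * u = S n)
    (hdet : u.det = 1) (h1 : u ≠ 1) :
    ∃ μ : ℂ, μ ≠ 1 ∧ ∃ v : State n, v ≠ 0 ∧ u *ᵥ v = μ • v ∧ v ⬝ᵥ (S n *ᵥ v) = 0 := by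
  by_contra! hno
  have hneg : ∀ μ : ℂ, μ ≠ 1 → ∀ v : State n, v ≠ 0 → u *ᵥ v = μ • v → μ = -1 := by
    intro μ hμ v hv h
    have h2 := dotProduct_S_mulVec_of_eigenvector hS h
    have h3 : (μ - 1) * (μ + 1) = 0 := by
      have : (μ ^ 2 - 1) * (v ⬝ᵥ (S n *ᵥ v)) = 0 := by linear_combination -h2
      rcases mul_eq_zero.mp this with h | h'
      · linear_combination h
      · exact absurd h' (hno μ hμ v hv h)
    rcases mul_eq_zero.mp h3 with h | h
    · exact absurd (sub_eq_zero.mp h) hμ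
    · exact eq_neg_of_add_eq_zero_left h
  have hm1 : (-1 : ℂ) ≠ 1 := by norm_num
  obtain ⟨μ, hμ, v, hv, huv⟩ := exists_eigenvector_ne_one hu h1
  obtain rfl := hneg μ hμ v hv huv
  -- A second vector in the eigenspace is a multiple of `v`: otherwise the quadratic polynomial
  -- `t ↦ C(w + t v, w + t v)` has a root.
  have hmul : ∀ w : State n, u *ᵥ w = (-1 : ℂ) • w → ∃ c : ℂ, w = c • v := by
    intro w hw
    have ha := hno (-1) hm1 v hv huv
    obtain ⟨t, ht⟩ : ∃ t : ℂ, (v ⬝ᵥ (S n *ᵥ v)) * (t * t) +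
        (w ⬝ᵥ (S n *ᵥ v) + v ⬝ᵥ (S n *ᵥ w)) * t + w ⬝ᵥ (S n *ᵥ w) = 0 := by
      refine exists_quadratic_eq_zero ha ?_
      obtain ⟨s, hs⟩ := IsAlgClosed.exists_pow_nat_eq (discrim (v ⬝ᵥ (S n *ᵥ v))
        (w ⬝ᵥ (S n *ᵥ v) + v ⬝ᵥ (S n *ᵥ w)) (w ⬝ᵥ (S n *ᵥ w))) (n := 2) two_pos
      exact ⟨s, by rw [← hs, sq]⟩
    refine ⟨-t, ?_⟩
    by_contra hne
    refine hno (-1) hm1 (w + t • v) ?_ ?_ ?_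
    · intro h
      exact hne (by rw [neg_smul]; exact eq_neg_of_add_eq_zero_left h)
    · rw [mulVec_add, mulVec_smul, hw, huv, smul_add, smul_comm]
    · simp only [mulVec_add, mulVec_smul, dotProduct_add, add_dotProduct, dotProduct_smul,
        smul_dotProduct, smul_eq_mul]
      linear_combination ht
  have hup : u * lineProj v = (-1 : ℂ) • lineProj v := mul_lineProj_of_mulVec_eq huv
  have hpu : lineProj v * u = (-1 : ℂ) • lineProj v :=
    mul_eq_smul_of_eq_smul hu (conjTranspose_lineProj v) (by simp) hup
  have hpp := lineProj_mul_self hv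
  -- Composing `u` with the reflection in `v` leaves only the eigenvalue `1`.
  have hr : u * (1 - (2 : ℂ) • lineProj v) = 1 := by
    have hrr : (1 - (2 : ℂ) • lineProj v)ᴴ * (1 - (2 : ℂ) • lineProj v) = 1 := by
      rw [conjTranspose_sub, conjTranspose_smul, conjTranspose_lineProj, conjTranspose_one]
      simp only [sub_mul, mul_sub, Matrix.smul_mul, Matrix.mul_smul, hpp, Matrix.one_mul,
        Matrix.mul_one, smul_smul, star_ofNat]
      module
    have hpr : lineProj v * (u * (1 - (2 : ℂ) • lineProj v)) = lineProj v := by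
      rw [← Matrix.mul_assoc, hpu, mul_sub, Matrix.mul_one, Matrix.smul_mul, Matrix.mul_smul, hpp]
      module
    by_contra hne
    obtain ⟨μ, hμ, y, hy, hey⟩ := exists_eigenvector_ne_one (u := u * (1 - (2 : ℂ) • lineProj v))
      (by rw [conjTranspose_mul, Matrix.mul_assoc, ← Matrix.mul_assoc uᴴ, hu, Matrix.one_mul, hrr])
      hne
    have hpy : lineProj v *ᵥ y = 0 := by
      have h := congrArg (lineProj v *ᵥ ·) hey
      simp only [mulVec_mulVec, hpr, mulVec_smul] at h
      have h' : (1 - μ) • (lineProj v *ᵥ y) = 0 := by rw [sub_smul, one_smul, ← h, sub_self]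
      exact (smul_eq_zero.mp h').resolve_left (sub_ne_zero.mpr (Ne.symm hμ))
    rw [← mulVec_mulVec, sub_mulVec, smul_mulVec, hpy, smul_zero, sub_zero, one_mulVec] at hey
    obtain rfl := hneg μ hμ y hy hey
    obtain ⟨c, rfl⟩ := hmul y hey
    rw [mulVec_smul, lineProj_mulVec_self hv] at hpy
    exact hy hpy
  have hd := congrArg det hr
  rw [det_mul, hdet, det_one_sub_two_smul_lineProj hv, det_one] at hd
  norm_num at hd

/-- The space of matrices fixed by left multiplication with `u`. -/
noncomputable def leftFixed (u : Mat n) : Submodule ℂ (Mat n) :=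
  LinearMap.ker (LinearMap.mulLeft ℂ (u - 1))

theorem mem_leftFixed {u A : Mat n} : A ∈ leftFixed u ↔ u * A = A := by
  simp [leftFixed, sub_mul, sub_eq_zero]

theorem exp_neg_mul_exp (X : Mat n) : exp (-X) * exp X = 1 := by
  rw [Matrix.exp_neg]
  exact nonsing_inv_mul _ ((isUnit_iff_isUnit_det _).mp (isUnit_exp _))

/-- `exp X` is the square of `exp (X / 2)`, which preserves the form of `S` and therefore has
determinant `±1`. -/
theorem det_exp_eq_one {X : Mat n} (hX : Xᴴ = -X) (hθ : thetaMat X = X) : (exp X).det = 1 := by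
  have hY : (exp ((1 / 2 : ℝ) • X))ᴴ * exp ((1 / 2 : ℝ) • X) = 1 := by
    rw [← exp_conjTranspose, conjTranspose_smul, hX, smul_neg, star_trivial, exp_neg_mul_exp]
  have hS := (thetaMat_eq_self_iff hY).mp (by rw [thetaMat_exp, thetaMat_smul, hθ])
  have hSdet : (S n).det ≠ 0 := fun h => by
    have := congrArg det (transpose_S_mul_S n)
    rw [det_mul, h, mul_zero, det_one] at this
    exact zero_ne_one this
  have h2 : (exp ((1 / 2 : ℝ) • X)).det * (exp ((1 / 2 : ℝ) • X)).det = 1 := by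
    have := congrArg det hS
    rw [det_mul, det_mul, det_transpose] at this
    apply mul_right_cancel₀ hSdet
    linear_combination this
  have h3 : X = (1 / 2 : ℝ) • X + (1 / 2 : ℝ) • X := by module
  rw [h3, exp_add_of_commute _ _ (Commute.refl _), det_mul, h2]

/-- Every unitary matrix of determinant one which preserves the bilinear form of `S` is the
exponential of a skew-Hermitian matrix fixed by `θ`. The logarithm is built by splitting off
isotropic eigenvectors `v` one at a time, together with their images under the antiunitary map
`v ↦ S⁻¹ v̄`; the last clause makes the successive summands commute. -/
theorem exists_exp_eq {u : Mat n} (hu : uᴴ * u = 1) (hθ : thetaMat u = u) (hdet : u.det = 1) :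
    ∃ X : Mat n, Xᴴ = -X ∧ thetaMat X = X ∧ exp X = u ∧ ∀ A, u * A = A → X * A = 0 := by
  induction hF : leftFixed u using (wellFounded_gt (α := Submodule ℂ (Mat n))).induction
    generalizing u with
  | _ F ih =>
  subst hF
  by_cases h1 : u = 1
  · exact ⟨0, by simp, by rw [thetaMat_eq]; simp [conjMat_eq], by simp [h1], by simp⟩
  obtain ⟨μ, hμ, v, hv, huv, hiso⟩ :=
    exists_isotropic_eigenvector hu ((thetaMat_eq_self_iff hu).mp hθ) hdet h1
  obtain ⟨p, hpp, hpH, hp0, hup, hpq⟩ : ∃ p : Mat n, p * p = p ∧ pᴴ = p ∧ p ≠ 0 ∧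
      u * p = μ • p ∧ p * thetaMat p = 0 :=
    ⟨lineProj v, lineProj_mul_self hv, conjTranspose_lineProj v, lineProj_ne_zero hv,
      mul_lineProj_of_mulVec_eq huv, lineProj_mul_thetaMat_lineProj hiso⟩
  obtain ⟨q, hq⟩ : ∃ q, q = thetaMat p := ⟨_, rfl⟩
  rw [← hq] at hpq
  have hθq : thetaMat q = p := by rw [hq, thetaMat_thetaMat]
  have hqq : q * q = q := by rw [hq, ← thetaMat_mul, hpp]
  have hqH : qᴴ = q := by rw [hq, ← thetaMat_conjTranspose, hpH]
  have hqp : q * p = 0 := by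
    have := congrArg conjTranspose hpq
    rwa [conjTranspose_mul, hpH, hqH, conjTranspose_zero] at this
  have hμμ : star μ * μ = 1 := star_mul_self_eq_one_of_eq_smul hu hp0 hup
  have huq : u * q = star μ • q := by
    have := congrArg thetaMat hup
    rwa [thetaMat_mul, hθ, thetaMat_complex_smul, ← hq] at this
  have hpu : p * u = μ • p := mul_eq_smul_of_eq_smul hu hpH hμμ hup
  have hqu : q * u = star μ • q :=
    mul_eq_smul_of_eq_smul hu hqH (by rw [star_star, mul_comm, hμμ]) huq
  have hμs : star μ ≠ 1 := fun h => hμ (by rw [← star_star μ, h, star_one])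
  have hkill : ∀ (r : Mat n) (c : ℂ), c ≠ 1 → r * u = c • r → ∀ A, u * A = A → r * A = 0 := by
    intro r c hc hr A hA
    have h : r * A = c • (r * A) := by
      conv_lhs => rw [← hA, ← Matrix.mul_assoc, hr, Matrix.smul_mul]
    have h' : (1 - c) • (r * A) = 0 := by rw [sub_smul, one_smul, ← h, sub_self]
    exact (smul_eq_zero.mp h').resolve_left (sub_ne_zero.mpr (Ne.symm hc))
  -- `c = i arg μ` is the logarithm of `μ`.
  obtain ⟨c, hc, hcs⟩ : ∃ c : ℂ, Complex.exp c = μ ∧ star c = -c := by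
    have hn : ‖μ‖ = 1 := by
      have h : ((‖μ‖ ^ 2 : ℝ) : ℂ) = 1 := by
        rw [← hμμ]; push_cast; exact (Complex.conj_mul' μ).symm
      have h' : ‖μ‖ ^ 2 = 1 := by exact_mod_cast h
      exact (pow_eq_one_iff_of_nonneg (norm_nonneg μ) two_ne_zero).mp h'
    refine ⟨Complex.arg μ * Complex.I, ?_, ?_⟩
    · have := Complex.norm_mul_exp_arg_mul_I μ
      rwa [hn, Complex.ofReal_one, one_mul] at this
    · simp
  have hcn : Complex.exp (-c) = star μ := by
    rw [← hcs, ← hc]; exact Complex.exp_conj c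
  have hYH : (c • (p - q))ᴴ = -(c • (p - q)) := by
    rw [conjTranspose_smul, conjTranspose_sub, hpH, hqH, hcs, neg_smul]
  have hYθ : thetaMat (c • (p - q)) = c • (p - q) := by
    rw [thetaMat_complex_smul, thetaMat_sub, ← hq, hθq, hcs]; module
  have hw : exp (-(c • (p - q))) = 1 + (star μ - 1) • p + (μ - 1) • q := by
    rw [← neg_smul, exp_smul_sub_of_orthogonal hpp hqq hpq hqp, neg_neg, hc, hcn]
  have hww : exp (-(c • (p - q))) * exp (c • (p - q)) = 1 := exp_neg_mul_exp _
  have hwp : exp (-(c • (p - q))) * p = star μ • p := by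
    rw [hw]; simp only [add_mul, Matrix.smul_mul, hpp, hqp, Matrix.one_mul]; module
  have hwq : exp (-(c • (p - q))) * q = μ • q := by
    rw [hw]; simp only [add_mul, Matrix.smul_mul, hqq, hpq, Matrix.one_mul]; module
  have hwA : ∀ A, u * A = A → exp (-(c • (p - q))) * A = A := by
    intro A hA
    rw [hw]
    simp [add_mul, hkill p μ hμ hpu A hA, hkill q _ hμs hqu A hA]
  have hu'p : u * exp (-(c • (p - q))) * p = p := by
    rw [Matrix.mul_assoc, hwp, Matrix.mul_smul, hup, smul_smul, hμμ, one_smul]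
  have hu'q : u * exp (-(c • (p - q))) * q = q := by
    rw [Matrix.mul_assoc, hwq, Matrix.mul_smul, huq, smul_smul, mul_comm, hμμ, one_smul]
  have hu'A : ∀ A, u * A = A → u * exp (-(c • (p - q))) * A = A := by
    intro A hA
    rw [Matrix.mul_assoc, hwA A hA, hA]
  have hlt : leftFixed u < leftFixed (u * exp (-(c • (p - q)))) := by
    refine lt_of_le_of_ne (fun A hA => mem_leftFixed.mpr (hu'A A (mem_leftFixed.mp hA))) ?_
    intro h
    have hp := mem_leftFixed.mpr hu'p
    rw [← h, mem_leftFixed, hup] at hp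
    have : (μ - 1) • p = 0 := by rw [sub_smul, one_smul, hp, sub_self]
    rcases smul_eq_zero.mp this with h | h
    · exact hμ (sub_eq_zero.mp h)
    · exact hp0 h
  obtain ⟨X, hXH, hXθ, hXexp, hXA⟩ := ih _ hlt (u := u * exp (-(c • (p - q))))
    (by
      rw [conjTranspose_mul, ← exp_conjTranspose, conjTranspose_neg, hYH, neg_neg,
        Matrix.mul_assoc, ← Matrix.mul_assoc uᴴ, hu, Matrix.one_mul]
      exact mul_eq_one_comm.mp hww)
    (by rw [thetaMat_mul, hθ, thetaMat_exp, ← neg_smul, thetaMat_complex_smul, thetaMat_sub, ← hq,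
          hθq, star_neg, hcs]; congr 2; module)
    (by
      rw [det_mul, hdet, one_mul, ← neg_smul]
      apply det_exp_eq_one
      · rw [neg_smul, conjTranspose_neg, hYH]
      · rw [thetaMat_complex_smul, thetaMat_sub, ← hq, hθq, star_neg, hcs]; module)
    rfl
  have hXY : X * (c • (p - q)) = 0 := by
    rw [Matrix.mul_smul, mul_sub, hXA p hu'p, hXA q hu'q, sub_self, smul_zero]
  have hYX : (c • (p - q)) * X = 0 := by
    have := congrArg conjTranspose hXY
    rwa [conjTranspose_mul, hYH, hXH, neg_mul_neg, conjTranspose_zero] at this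
  refine ⟨X + c • (p - q), ?_, ?_, ?_, ?_⟩
  · rw [conjTranspose_add, hXH, hYH, neg_add]
  · rw [thetaMat_add, hXθ, hYθ]
  · rw [exp_add_of_commute _ _ (by rw [commute_iff_eq, hXY, hYX]), hXexp, Matrix.mul_assoc, hww,
      Matrix.mul_one]
  · intro A hA
    rw [add_mul, hXA A (hu'A A hA), Matrix.smul_mul, sub_mul, hkill p μ hμ hpu A hA,
      hkill q _ hμs hqu A hA]
    simp

attribute [local instance] LieRing.ofAssociativeRing

theorem mem_kAlg_iff (X : su n) : X ∈ kAlg n ↔ thetaMat (X : Mat n) = X := by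
  rw [kAlg, Module.End.mem_eigenspace_iff, one_smul]
  exact Subtype.ext_iff

/-- `K` is the symmetry group, within `SU(N)`, of the bilinear form of `S`. -/
theorem mem_K_iff (u : Mat n) : u ∈ K n ↔
    u ∈ specialUnitaryGroup (Fin (2 ^ n)) ℂ ∧ uᵀ * S n * u = S n := by
  constructor
  · rintro ⟨X, hX, rfl⟩
    rw [mem_kAlg_iff] at hX
    have hu : (exp (X : Mat n))ᴴ * exp (X : Mat n) = 1 := by
      rw [← exp_conjTranspose, X.2.1, exp_neg_mul_exp]
    refine ⟨mem_specialUnitaryGroup_iff.mpr ⟨mem_unitaryGroup_iff'.mpr hu,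
      det_exp_eq_one X.2.1 hX⟩, (thetaMat_eq_self_iff hu).mp ?_⟩
    rw [thetaMat_exp, hX]
  · rintro ⟨hu, hS⟩
    obtain ⟨huu, hdet⟩ := mem_specialUnitaryGroup_iff.mp hu
    have hu' : uᴴ * u = 1 := mem_unitaryGroup_iff'.mp huu
    obtain ⟨X, hXH, hXθ, hX, -⟩ := exists_exp_eq hu' ((thetaMat_eq_self_iff hu').mpr hS) hdet
    -- `X` is conjugate to `X̄ = -Xᵀ`.
    have htr : X.trace = 0 := by
      have h : X.trace = -X.trace := by
        conv_lhs => rw [← hXθ, thetaMat_eq, conjMat_eq, hXH, Matrix.mul_assoc, trace_mul_comm,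
          Matrix.mul_assoc, S_mul_transpose_S, Matrix.mul_one, trace_transpose, trace_neg]
      exact self_eq_neg.mp h
    exact ⟨⟨X, hXH, htr⟩, (mem_kAlg_iff _).mpr hXθ, hX⟩

/-! ### The entries of `S` and the standard entangler -/

theorem finFunctionFinEquiv_rev (f : Fin n → Fin 2) :
    finFunctionFinEquiv (fun i => (f i).rev) = (finFunctionFinEquiv f).rev := by
  have h : ((finFunctionFinEquiv (fun i => (f i).rev) : Fin (2 ^ n)) : ℕ) +
      (finFunctionFinEquiv f : Fin (2 ^ n)) = 2 ^ n - 1 := by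
    rw [finFunctionFinEquiv_apply, finFunctionFinEquiv_apply, ← Finset.sum_add_distrib]
    have h1 : ∀ i : Fin n, ((f i).rev : ℕ) * 2 ^ (i : ℕ) + (f i : ℕ) * 2 ^ (i : ℕ) =
        2 ^ (i : ℕ) := by
      intro i
      have h2 : ((f i).rev : ℕ) + (f i : ℕ) = 1 := by rw [Fin.val_rev]; omega
      rw [← add_mul, h2, one_mul]
    rw [Finset.sum_congr rfl fun i _ => h1 i, Fin.sum_univ_eq_sum_range (fun i => 2 ^ i),
      Nat.geomSum_eq le_rfl]
    simp
  apply Fin.ext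
  rw [Fin.val_rev]
  omega

theorem qubit_rev (j : Fin (2 ^ n)) (i : Fin n) : qubit j.rev i = (qubit j i).rev := by
  obtain ⟨f, rfl⟩ := finFunctionFinEquiv.surjective j
  rw [← finFunctionFinEquiv_rev, qubit, qubit, Equiv.symm_apply_apply, Equiv.symm_apply_apply]

theorem qubit_injective : Function.Injective (qubit : Fin (2 ^ n) → Fin n → Fin 2) := by
  intro j k h
  apply finFunctionFinEquiv.symm.injective
  funext i
  simpa [qubit] using congrFun h i.rev

/-- `S|c⟩ = (-1) ^ #c |N - 1 - c⟩`. -/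
theorem S_apply (r c : Fin (2 ^ n)) : S n r c = if r = c.rev then (-1) ^ numOnes c else 0 := by
  have hA : ∀ a b : Fin 2, (!![0, -1; 1, 0] : Matrix (Fin 2) (Fin 2) ℂ) a b =
      if a = b.rev then (-1) ^ (b : ℕ) else 0 := by
    intro a b; fin_cases a <;> fin_cases b <;> simp
  simp only [S, negI_pauliY, tensorPow, of_apply, hA]
  split_ifs with h
  · subst h
    simp only [qubit_rev, if_true, numOnes, Finset.prod_pow_eq_pow_sum]
  · obtain ⟨i, hi⟩ : ∃ i, qubit r i ≠ qubit c.rev i := by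
      by_contra! hh
      exact h (qubit_injective (funext hh))
    exact Finset.prod_eq_zero (Finset.mem_univ i) (if_neg (by rwa [← qubit_rev]))

/-- The coordinate matrix `|i⟩ ↦ |f i⟩`. -/
def coordMat {ι : Type*} (f : ι → Fin (2 ^ n)) : Matrix (Fin (2 ^ n)) ι ℂ :=
  (1 : Mat n).submatrix id f

theorem mul_coordMat {ι κ : Type*} (f : ι → Fin (2 ^ n)) (X : Matrix κ (Fin (2 ^ n)) ℂ) :
    X * coordMat f = X.submatrix id f := by
  ext i j
  simp [coordMat, mul_apply, one_apply]

theorem coordMat_transpose_mul {ι κ : Type*} (f : ι → Fin (2 ^ n))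
    (X : Matrix (Fin (2 ^ n)) κ ℂ) : (coordMat f)ᵀ * X = X.submatrix f id := by
  ext i j
  simp [coordMat, mul_apply, one_apply]

/-- The basis states with label less than `N / 2` span a totally isotropic subspace. -/
theorem coordMat_transpose_mul_S_mul (hn : 0 < n) {ι : Type*} {f : ι → Fin (2 ^ n)}
    (hf : ∀ i, (f i : ℕ) < 2 ^ n / 2) : (coordMat f)ᵀ * (S n * coordMat f) = 0 := by
  rw [mul_coordMat, coordMat_transpose_mul]
  ext i j
  rw [submatrix_apply, submatrix_apply, S_apply, if_neg, Matrix.zero_apply]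
  intro h
  have h1 := congrArg Fin.val h
  obtain ⟨m, rfl⟩ := Nat.exists_eq_succ_of_ne_zero hn.ne'
  have h2 := hf i
  have h3 := hf j
  simp only [id, Fin.val_rev] at h1
  have h4 : 2 ^ m.succ = 2 * 2 ^ m := pow_succ' 2 m
  omega

theorem coordMat_transpose_mul_self {ι : Type*} (f : ι → Fin (2 ^ n)) :
    (coordMat f)ᵀ * coordMat f = (1 : Mat n).submatrix f f := by
  rw [mul_coordMat]; ext i j; simp [coordMat, one_apply]

theorem coordMat_transpose_mul_transpose_S_mul (hn : 0 < n) {ι : Type*} {f : ι → Fin (2 ^ n)}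
    (hf : ∀ i, (f i : ℕ) < 2 ^ n / 2) : (coordMat f)ᵀ * ((S n)ᵀ * coordMat f) = 0 := by
  have := congrArg transpose (coordMat_transpose_mul_S_mul hn hf)
  rwa [transpose_mul, transpose_mul, transpose_transpose, Matrix.mul_assoc, transpose_zero] at this

/-- The index `j` of the summand of `E₀` which contributes to the columns `2 j` and `2 j + 1`. -/
def half (c : Fin (2 ^ n)) : Fin (2 ^ n) := ⟨c / 2, by omega⟩

/-- The factor `1` or `i` in column `2 j` or `2 j + 1` of `E₀`. -/
noncomputable def phase (c : Fin (2 ^ n)) : ℂ := Complex.I ^ ((c : ℕ) % 2)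

/-- The sign with which `S|j⟩` enters column `2 j` or `2 j + 1` of `E₀`. -/
noncomputable def sgn (c : Fin (2 ^ n)) : ℂ := (-1) ^ ((c : ℕ) % 2)

theorem val_half_lt (hn : 0 < n) (c : Fin (2 ^ n)) : (half c : ℕ) < 2 ^ n / 2 := by
  obtain ⟨m, rfl⟩ := Nat.exists_eq_succ_of_ne_zero hn.ne'
  have h4 : 2 ^ m.succ = 2 * 2 ^ m := pow_succ' 2 m
  have := c.2
  simp only [half]
  omega

theorem E₀_apply (hn : 0 < n) (r c : Fin (2 ^ n)) :
    E₀ n r c = ((1 / Real.sqrt 2 : ℝ) : ℂ) *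
      (((if r = half c then 1 else 0) + S n r (half c) * sgn c) * phase c) := by
  rw [E₀, Matrix.smul_apply, smul_eq_mul]
  congr 1
  rw [Matrix.sum_apply, Finset.sum_eq_single (half c)]
  · have hr : ((r : ℕ) = 2 ^ n - (half c : ℕ) - 1) ↔ r = (half c).rev := by
      rw [Fin.ext_iff, Fin.val_rev, Nat.sub_sub]
    rcases Nat.mod_two_eq_zero_or_one (c : ℕ) with h | h
    · have h1 : (c : ℕ) = 2 * (half c : ℕ) := by simp only [half]; omega
      simp only [ketBra, Matrix.add_apply, Matrix.sub_apply, Matrix.smul_apply, of_apply, hr,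
        phase, sgn, h, S_apply, Fin.ext_iff (a := r) (b := half c), ← h1, and_true]
      simp
    · have h1 : (c : ℕ) = 2 * (half c : ℕ) + 1 := by simp only [half]; omega
      have h2 : ¬ (c : ℕ) = 2 * (half c : ℕ) := by omega
      simp only [ketBra, Matrix.add_apply, Matrix.sub_apply, Matrix.smul_apply, of_apply, hr, h2,
        phase, sgn, h, S_apply, Fin.ext_iff (a := r) (b := half c), and_false, ← h1, and_true]
      simp
      split_ifs <;> ring
  · intro j _ hj
    have h1 : ¬ (c : ℕ) = 2 * (j : ℕ) := fun h => hj (Fin.ext (by simp only [half]; omega))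
    have h2 : ¬ (c : ℕ) = 2 * (j : ℕ) + 1 := fun h => hj (Fin.ext (by simp only [half]; omega))
    simp [ketBra, h1, h2]
  · intro h
    exact absurd (by simpa using val_half_lt hn c) h

/-- Column `c` of `E₀` is a multiple of `|j⟩ ± S|j⟩` with `j = half c`. -/
theorem E₀_eq (hn : 0 < n) : E₀ n = ((1 / Real.sqrt 2 : ℝ) : ℂ) •
    ((coordMat half + S n * coordMat half * diagonal sgn) * diagonal phase) := by
  ext r c
  rw [E₀_apply hn, mul_coordMat, Matrix.smul_apply, mul_diagonal, Matrix.add_apply, mul_diagonal]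
  simp [coordMat, one_apply]

theorem inv_sqrt_two_mul_self :
    ((1 / Real.sqrt 2 : ℝ) : ℂ) * ((1 / Real.sqrt 2 : ℝ) : ℂ) = 1 / 2 := by
  rw [← Complex.ofReal_mul, div_mul_div_comm, Real.mul_self_sqrt (by norm_num)]
  norm_num

theorem phase_mul_self (c : Fin (2 ^ n)) : phase c * phase c = sgn c := by
  rw [phase, sgn, ← mul_pow, Complex.I_mul_I]

theorem star_phase_mul_self (c : Fin (2 ^ n)) : star (phase c) * phase c = 1 := by
  rw [phase, star_pow, ← mul_pow]
  simp

theorem sgn_mul_self (c : Fin (2 ^ n)) : sgn c * sgn c = 1 := by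
  rw [sgn, ← mul_pow]
  simp

theorem sgn_eq_neg {c d : Fin (2 ^ n)} (h : half c = half d) (hcd : c ≠ d) :
    sgn c = -sgn d := by
  have h1 := congrArg Fin.val h
  have h2 : (c : ℕ) ≠ d := fun h => hcd (Fin.ext h)
  simp only [half] at h1
  have h3 : (c : ℕ) % 2 + (d : ℕ) % 2 = 1 := by omega
  rcases Nat.mod_two_eq_zero_or_one (c : ℕ) with hc | hc <;> rw [hc] at h3
  · have hd : (d : ℕ) % 2 = 1 := by omega
    simp [sgn, hc, hd]
  · have hd : (d : ℕ) % 2 = 0 := by omega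
    simp [sgn, hc, hd]

/-- For `n` even, the vectors `E₀|j⟩` are orthonormal for the concurrence form. -/
theorem E₀_transpose_mul_S_mul (hn : 0 < n) (he : Even n) : (E₀ n)ᵀ * S n * E₀ n = 1 := by
  have hSS : S n * S n = 1 := by rw [S_mul_S, he.neg_one_pow, one_smul]
  have hST : (S n)ᵀ = S n := by rw [transpose_S, he.neg_one_pow, one_smul]
  have h0 := coordMat_transpose_mul_S_mul hn (f := half) (val_half_lt hn)
  have h1 : (coordMat half + S n * coordMat half * diagonal sgn)ᵀ * S n *
      (coordMat half + S n * coordMat half * diagonal sgn) =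
      (1 : Mat n).submatrix half half * diagonal sgn +
      diagonal sgn * (1 : Mat n).submatrix half half := by
    simp only [transpose_add, transpose_mul, hST, diagonal_transpose, add_mul, mul_add,
      ← coordMat_transpose_mul_self]
    have e1 : (coordMat half)ᵀ * S n * coordMat (n := n) half = 0 := by
      rw [Matrix.mul_assoc, h0]
    have e2 : (coordMat half)ᵀ * S n * (S n * coordMat half * diagonal sgn) =
        (coordMat half)ᵀ * coordMat (n := n) half * diagonal sgn := by
      calc _ = (coordMat half)ᵀ * (S n * S n) * coordMat half * diagonal sgn := by
            simp only [Matrix.mul_assoc]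
        _ = _ := by rw [hSS, Matrix.mul_one]
    have e3 : diagonal sgn * ((coordMat half)ᵀ * S n) * S n * coordMat half =
        diagonal sgn * ((coordMat half)ᵀ * coordMat (n := n) half) := by
      calc _ = diagonal sgn * ((coordMat half)ᵀ * (S n * S n) * coordMat half) := by
            simp only [Matrix.mul_assoc]
        _ = _ := by rw [hSS, Matrix.mul_one]
    have e4 : diagonal sgn * ((coordMat half)ᵀ * S n) * S n * (S n * coordMat half * diagonal sgn)
        = (0 : Mat n) := by
      calc _ = diagonal sgn * ((coordMat half)ᵀ * (S n * S n) * (S n * coordMat half)) *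
              diagonal sgn := by simp only [Matrix.mul_assoc]
        _ = _ := by rw [hSS, Matrix.mul_one, h0, Matrix.mul_zero, Matrix.zero_mul]
    rw [e1, e2, e3, e4]
    abel
  rw [E₀_eq hn, transpose_smul, transpose_mul, diagonal_transpose]
  simp only [Matrix.smul_mul, Matrix.mul_smul, smul_smul, inv_sqrt_two_mul_self]
  rw [show ∀ D B : Mat n, D * Bᵀ * S n * (B * D) = D * (Bᵀ * S n * B) * D from
    fun D B => by simp only [Matrix.mul_assoc], h1]
  ext c d
  rw [Matrix.smul_apply, mul_diagonal, diagonal_mul, Matrix.add_apply, mul_diagonal, diagonal_mul,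
    submatrix_apply, one_apply, one_apply]
  by_cases h : half c = half d
  · by_cases hcd : c = d
    · subst hcd
      rw [if_pos rfl, if_pos rfl, smul_eq_mul]
      linear_combination sgn c * phase_mul_self c + sgn_mul_self c
    · rw [if_pos h, if_neg hcd, smul_eq_mul, sgn_eq_neg h hcd]
      ring
  · have : c ≠ d := fun h' => h (by rw [h'])
    simp [h, this]

theorem E₀_conjTranspose_mul_self (hn : 0 < n) : (E₀ n)ᴴ * E₀ n = 1 := by
  have h0 := coordMat_transpose_mul_S_mul hn (f := half) (val_half_lt hn)
  have h0' := coordMat_transpose_mul_transpose_S_mul hn (f := half) (val_half_lt hn)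
  have hA : (coordMat (n := n) half)ᴴ = (coordMat half)ᵀ := by
    ext i j; simp [coordMat, one_apply, apply_ite]
  have hD : (diagonal sgn : Mat n)ᴴ = diagonal sgn := by
    rw [diagonal_conjTranspose]; congr 1; funext c; simp [sgn]
  have h1 : (coordMat half + S n * coordMat half * diagonal sgn)ᴴ *
      (coordMat half + S n * coordMat half * diagonal sgn) =
      (1 : Mat n).submatrix half half +
      diagonal sgn * (1 : Mat n).submatrix half half * diagonal sgn := by
    simp only [conjTranspose_add, conjTranspose_mul, hA, hD, ← transpose_S_eq_conjTranspose,
      add_mul, mul_add, ← coordMat_transpose_mul_self]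
    have e2 : (coordMat half)ᵀ * (S n * coordMat half * diagonal sgn) = (0 : Mat n) := by
      rw [← Matrix.mul_assoc, h0, Matrix.zero_mul]
    have e3 : diagonal sgn * ((coordMat half)ᵀ * (S n)ᵀ) * coordMat half = (0 : Mat n) := by
      rw [Matrix.mul_assoc, Matrix.mul_assoc, h0', Matrix.mul_zero]
    have e4 : diagonal sgn * ((coordMat half)ᵀ * (S n)ᵀ) * (S n * coordMat half * diagonal sgn)
        = diagonal sgn * ((coordMat half)ᵀ * coordMat (n := n) half) * diagonal sgn := by
      calc _ = diagonal sgn * ((coordMat half)ᵀ * ((S n)ᵀ * S n) * coordMat half) *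
              diagonal sgn := by simp only [Matrix.mul_assoc]
        _ = _ := by rw [transpose_S_mul_S, Matrix.mul_one]
    rw [e2, e3, e4]
    abel
  rw [E₀_eq hn, conjTranspose_smul, conjTranspose_mul]
  simp only [Matrix.smul_mul, Matrix.mul_smul, smul_smul, Complex.star_def, Complex.conj_ofReal,
    inv_sqrt_two_mul_self]
  rw [show ∀ D B : Mat n, Dᴴ * Bᴴ * (B * D) = Dᴴ * (Bᴴ * B) * D from
    fun D B => by simp only [Matrix.mul_assoc], h1]
  ext c d
  rw [diagonal_conjTranspose, Matrix.smul_apply, mul_diagonal, diagonal_mul, Matrix.add_apply,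
    mul_diagonal, diagonal_mul, submatrix_apply, one_apply, one_apply]
  by_cases h : half c = half d
  · by_cases hcd : c = d
    · subst hcd
      rw [if_pos rfl, if_pos rfl, smul_eq_mul, Pi.star_apply]
      linear_combination star_phase_mul_self c +
        (1 / 2) * (star (phase c) * phase c) * sgn_mul_self c
    · rw [if_pos h, if_neg hcd, smul_eq_mul, sgn_eq_neg h hcd]
      linear_combination (-1 / 2) * (star phase c * phase d) * sgn_mul_self d
  · have : c ≠ d := fun h' => h (by rw [h'])
    simp [h, this]

/-! ### The symmetry group of the concurrence form -/

/-- The symmetry group, inside `SU(N)`, of the concurrence form. -/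
noncomputable def symmetryGroup (n : ℕ) : Subgroup (specialUnitaryGroup (Fin (2 ^ n)) ℂ) where
  carrier := {u | (u : Mat n)ᵀ * S n * (u : Mat n) = S n}
  one_mem' := by simp
  mul_mem' := by
    intro V W hV hW
    simp only [Set.mem_ofPred_eq, Submonoid.coe_mul, transpose_mul] at hV hW ⊢
    calc _ = (W.1)ᵀ * ((V.1)ᵀ * S n * V.1) * W.1 := by simp only [Matrix.mul_assoc]
      _ = _ := by rw [hV, hW]
  inv_mem' := by
    intro V hV
    simp only [Set.mem_ofPred_eq] at hV ⊢
    have h1 : V.1 * (V⁻¹).1 = 1 := by rw [← Submonoid.coe_mul, mul_inv_cancel, Submonoid.coe_one]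
    have h2 : ((V⁻¹).1)ᵀ * (V.1)ᵀ = 1 := by rw [← transpose_mul, h1, transpose_one]
    calc _ = ((V⁻¹).1)ᵀ * ((V.1)ᵀ * S n * V.1) * (V⁻¹).1 := by rw [hV]
      _ = (((V⁻¹).1)ᵀ * (V.1)ᵀ) * S n * (V.1 * (V⁻¹).1) := by simp only [Matrix.mul_assoc]
      _ = _ := by rw [h2, h1, Matrix.one_mul, Matrix.mul_one]

theorem mem_symmetryGroup {u : specialUnitaryGroup (Fin (2 ^ n)) ℂ} :
    u ∈ symmetryGroup n ↔ (u : Mat n)ᵀ * S n * (u : Mat n) = S n := Iff.rfl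

theorem conjTranspose_mul_self_of_mem {ι R : Type*} [Fintype ι] [DecidableEq ι] [CommRing R]
    [StarRing R] {u : Matrix ι ι R} (hu : u ∈ specialUnitaryGroup ι R) : uᴴ * u = 1 :=
  mem_unitaryGroup_iff'.mp (mem_specialUnitaryGroup_iff.mp hu).1

/-- Conjugation with a unitary matrix, possibly relabelling the index set, preserves the special
unitary group. -/
theorem conjTranspose_mul_mul_mem_specialUnitaryGroup {ι κ : Type*} [Fintype ι] [DecidableEq ι]
    [Fintype κ] [DecidableEq κ] {W : Matrix ι κ ℂ} (h1 : Wᴴ * W = 1) (h2 : W * Wᴴ = 1)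
    {u : Matrix ι ι ℂ} (hu : u ∈ specialUnitaryGroup ι ℂ) :
    Wᴴ * u * W ∈ specialUnitaryGroup κ ℂ := by
  refine mem_specialUnitaryGroup_iff.mpr ⟨mem_unitaryGroup_iff'.mpr ?_, ?_⟩
  · rw [star_eq_conjTranspose]
    calc (Wᴴ * u * W)ᴴ * (Wᴴ * u * W) = Wᴴ * uᴴ * (W * Wᴴ) * u * W := by
          simp only [conjTranspose_mul, conjTranspose_conjTranspose, Matrix.mul_assoc]
      _ = Wᴴ * (uᴴ * u) * W := by rw [h2, Matrix.mul_one]; simp only [Matrix.mul_assoc]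
      _ = 1 := by rw [conjTranspose_mul_self_of_mem hu, Matrix.mul_one, h1]
  · rw [det_conj_of_mul_eq_one h1 h2, (mem_specialUnitaryGroup_iff.mp hu).2]

theorem form_mulVec (u : Mat n) (φ ψ : State n) :
    form n (u *ᵥ φ) (u *ᵥ ψ) = φ ⬝ᵥ ((uᵀ * S n * u) *ᵥ ψ) := by
  rw [form_apply, ← mulVec_mulVec, ← mulVec_mulVec, dotProduct_mulVec φ, vecMul_transpose]

theorem form_invariant_iff (u : Mat n) :
    (∀ φ ψ : State n, form n (u *ᵥ φ) (u *ᵥ ψ) = form n φ ψ) ↔ uᵀ * S n * u = S n := by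
  simp only [form_mulVec]
  simp only [form_apply]
  constructor
  · intro h
    ext i j
    simpa using h (Pi.single i 1) (Pi.single j 1)
  · intro h φ ψ
    rw [h]

theorem form_swap (φ ψ : State n) : form n ψ φ = (-1) ^ n * form n φ ψ := by
  rw [form_apply, form_apply, dotProduct_mulVec φ, ← mulVec_transpose, transpose_S, smul_mulVec,
    smul_dotProduct, smul_eq_mul, ← mul_assoc, ← mul_pow, dotProduct_comm]
  simp

theorem form_nondegenerate (n : ℕ) : (form n).Nondegenerate := by
  refine LinearMap.BilinForm.nondegenerate_toBilin'_of_det_ne_zero' _ fun h => ?_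
  have := congrArg det (transpose_S_mul_S n)
  rw [det_mul, h, mul_zero, det_one] at this
  exact zero_ne_one this

/-! ### An even number of qubits -/

theorem E₀_mul_conjTranspose (hn : 0 < n) : E₀ n * (E₀ n)ᴴ = 1 :=
  mul_eq_one_comm.mp (E₀_conjTranspose_mul_self hn)

theorem E₀_mul_transpose (hn : 0 < n) (he : Even n) : E₀ n * (E₀ n)ᵀ = S n := by
  have hSS : S n * S n = 1 := by rw [S_mul_S, he.neg_one_pow, one_smul]
  have h : E₀ n * ((E₀ n)ᵀ * S n) = 1 := mul_eq_one_comm.mp (E₀_transpose_mul_S_mul hn he)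
  calc E₀ n * (E₀ n)ᵀ = E₀ n * ((E₀ n)ᵀ * S n) * S n := by
        simp only [Matrix.mul_assoc, hSS, Matrix.mul_one]
    _ = S n := by rw [h, Matrix.one_mul]

theorem conjMat_E₀_mul_conjTranspose (hn : 0 < n) (he : Even n) :
    conjMat (E₀ n) * (E₀ n)ᴴ = S n := by
  have h := congrArg conjMat (E₀_mul_transpose hn he)
  rw [conjMat_mul, conjMat_S] at h
  exact h

/-- A symmetry of the concurrence form is real in the basis `E₀|j⟩`. -/
theorem conjMat_E₀_conj (hn : 0 < n) (he : Even n) {u : Mat n} (hu : uᴴ * u = 1)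
    (hS : uᵀ * S n * u = S n) :
    conjMat ((E₀ n)ᴴ * u * E₀ n) = (E₀ n)ᴴ * u * E₀ n := by
  have hE := E₀_mul_conjTranspose hn
  have hM : ((E₀ n)ᴴ * u * E₀ n)ᵀ * ((E₀ n)ᴴ * u * E₀ n) = 1 := by
    calc _ = (E₀ n)ᵀ * uᵀ * (conjMat (E₀ n) * (E₀ n)ᴴ) * u * E₀ n := by
          simp only [transpose_mul, conjMat_eq, Matrix.mul_assoc]
      _ = (E₀ n)ᵀ * (uᵀ * S n * u) * E₀ n := by
          rw [conjMat_E₀_mul_conjTranspose hn he]; simp only [Matrix.mul_assoc]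
      _ = 1 := by rw [hS, E₀_transpose_mul_S_mul hn he]
  have hM' : ((E₀ n)ᴴ * u * E₀ n)ᴴ * ((E₀ n)ᴴ * u * E₀ n) = 1 := by
    calc _ = (E₀ n)ᴴ * uᴴ * (E₀ n * (E₀ n)ᴴ) * u * E₀ n := by
          simp only [conjTranspose_mul, conjTranspose_conjTranspose, Matrix.mul_assoc]
      _ = (E₀ n)ᴴ * (uᴴ * u) * E₀ n := by
          rw [hE, Matrix.mul_one]; simp only [Matrix.mul_assoc]
      _ = 1 := by rw [hu, Matrix.mul_one, E₀_conjTranspose_mul_self hn]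
  have h : ((E₀ n)ᴴ * u * E₀ n)ᴴ = ((E₀ n)ᴴ * u * E₀ n)ᵀ := by
    rw [← inv_eq_left_inv hM, ← inv_eq_left_inv hM']
  rw [conjMat_eq, h, transpose_transpose]

theorem map_re_map_ofReal {M : Mat n} (h : conjMat M = M) :
    (M.map Complex.re).map Complex.ofReal = M := by
  ext i j
  exact Complex.conj_eq_iff_re.mp (congrFun (congrFun h i) j)

theorem map_ofReal_injective {ι : Type*} :
    Function.Injective fun M : Matrix ι ι ℝ => M.map Complex.ofReal :=
  Matrix.map_injective Complex.ofReal_injective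

theorem map_ofReal_mul {ι : Type*} [Fintype ι] (A B : Matrix ι ι ℝ) :
    (A * B).map Complex.ofReal = A.map Complex.ofReal * B.map Complex.ofReal :=
  Matrix.map_mul (f := Complex.ofRealHom)

theorem map_ofReal_mem_specialUnitaryGroup_iff {ι : Type*} [Fintype ι] [DecidableEq ι]
    {M : Matrix ι ι ℝ} :
    M.map Complex.ofReal ∈ specialUnitaryGroup ι ℂ ↔ M ∈ specialOrthogonalGroup ι ℝ := by
  have h1 : (M.map Complex.ofReal).det = M.det := (Complex.ofRealHom.map_det M).symm
  have h2 : star (M.map Complex.ofReal) * M.map Complex.ofReal =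
      (star M * M).map Complex.ofReal := by
    rw [map_ofReal_mul]; congr 1; ext i j; simp
  have h3 : (1 : Matrix ι ι ℂ) = (1 : Matrix ι ι ℝ).map Complex.ofReal := by
    ext i j; simp [one_apply, apply_ite]
  rw [mem_specialUnitaryGroup_iff, mem_specialUnitaryGroup_iff, mem_unitaryGroup_iff',
    mem_unitaryGroup_iff', h1, h2, h3, map_ofReal_injective.eq_iff, Complex.ofReal_eq_one]

/-- Conversely, `E₀ M E₀ᴴ` preserves the concurrence form for every real orthogonal `M`. -/
theorem conj_real_mem_symmetry (hn : 0 < n) (he : Even n)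
    {M : Matrix (Fin (2 ^ n)) (Fin (2 ^ n)) ℝ} (hM : M ∈ specialOrthogonalGroup (Fin (2 ^ n)) ℝ) :
    (E₀ n * M.map Complex.ofReal * (E₀ n)ᴴ)ᵀ * S n * (E₀ n * M.map Complex.ofReal * (E₀ n)ᴴ) =
      S n := by
  have hMM : (M.map Complex.ofReal)ᵀ * M.map Complex.ofReal = 1 := by
    rw [← conjTranspose_mul_self_of_mem (map_ofReal_mem_specialUnitaryGroup_iff.mpr hM)]
    congr 1; ext i j; simp
  calc _ = conjMat (E₀ n) * (M.map Complex.ofReal)ᵀ * ((E₀ n)ᵀ * S n * E₀ n) *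
        M.map Complex.ofReal * (E₀ n)ᴴ := by
        simp only [transpose_mul, conjMat_eq, Matrix.mul_assoc]
    _ = conjMat (E₀ n) * ((M.map Complex.ofReal)ᵀ * M.map Complex.ofReal) * (E₀ n)ᴴ := by
        rw [E₀_transpose_mul_S_mul hn he, Matrix.mul_one]; simp only [Matrix.mul_assoc]
    _ = S n := by rw [hMM, Matrix.mul_one, conjMat_E₀_mul_conjTranspose hn he]

theorem map_re_E₀_conj (hn : 0 < n) (he : Even n) (u : symmetryGroup n) :
    (((E₀ n)ᴴ * (u : Mat n) * E₀ n).map Complex.re).map Complex.ofReal =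
      (E₀ n)ᴴ * (u : Mat n) * E₀ n :=
  map_re_map_ofReal (conjMat_E₀_conj hn he (conjTranspose_mul_self_of_mem u.1.2) u.2)

/-- Conjugation with the standard entangler identifies the symmetry group with `SO(N)`. -/
noncomputable def symmetryGroupEquivSO (hn : 0 < n) (he : Even n) :
    symmetryGroup n ≃ₜ* specialOrthogonalGroup (Fin (2 ^ n)) ℝ where
  toFun u := ⟨((E₀ n)ᴴ * (u : Mat n) * E₀ n).map Complex.re,
    map_ofReal_mem_specialUnitaryGroup_iff.mp <| by
      rw [map_re_E₀_conj hn he]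
      exact conjTranspose_mul_mul_mem_specialUnitaryGroup (E₀_conjTranspose_mul_self hn)
        (E₀_mul_conjTranspose hn) u.1.2⟩
  invFun M := ⟨⟨E₀ n * M.1.map Complex.ofReal * (E₀ n)ᴴ, by
      have := conjTranspose_mul_mul_mem_specialUnitaryGroup (W := (E₀ n)ᴴ)
        (by rw [conjTranspose_conjTranspose, E₀_mul_conjTranspose hn])
        (by rw [conjTranspose_conjTranspose, E₀_conjTranspose_mul_self hn])
        (map_ofReal_mem_specialUnitaryGroup_iff.mpr M.2)
      rwa [conjTranspose_conjTranspose] at this⟩, conj_real_mem_symmetry hn he M.2⟩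
  left_inv u := by
    apply Subtype.ext
    apply Subtype.ext
    change E₀ n * (((E₀ n)ᴴ * (u : Mat n) * E₀ n).map Complex.re).map Complex.ofReal * (E₀ n)ᴴ =
      (u : Mat n)
    rw [map_re_E₀_conj hn he]
    calc _ = (E₀ n * (E₀ n)ᴴ) * (u : Mat n) * (E₀ n * (E₀ n)ᴴ) := by simp only [Matrix.mul_assoc]
      _ = _ := by rw [E₀_mul_conjTranspose hn, Matrix.one_mul, Matrix.mul_one]
  right_inv M := by
    apply Subtype.ext
    change ((E₀ n)ᴴ * (E₀ n * M.1.map Complex.ofReal * (E₀ n)ᴴ) * E₀ n).map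
      Complex.re = M.1
    have h : (E₀ n)ᴴ * (E₀ n * M.1.map Complex.ofReal * (E₀ n)ᴴ) * E₀ n =
        M.1.map Complex.ofReal := by
      calc _ = ((E₀ n)ᴴ * E₀ n) * M.1.map Complex.ofReal * ((E₀ n)ᴴ * E₀ n) := by
            simp only [Matrix.mul_assoc]
        _ = _ := by rw [E₀_conjTranspose_mul_self hn, Matrix.one_mul, Matrix.mul_one]
    rw [h]
    ext i j
    simp
  map_mul' u v := by
    apply Subtype.ext
    apply map_ofReal_injective
    change (((E₀ n)ᴴ * ((u * v : symmetryGroup n) : Mat n) * E₀ n).map Complex.re).map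
      Complex.ofReal = (((E₀ n)ᴴ * (u : Mat n) * E₀ n).map Complex.re *
        ((E₀ n)ᴴ * (v : Mat n) * E₀ n).map Complex.re).map Complex.ofReal
    rw [map_ofReal_mul, map_re_E₀_conj hn he, map_re_E₀_conj hn he, map_re_E₀_conj hn he,
      Subgroup.coe_mul, Submonoid.coe_mul]
    calc _ = (E₀ n)ᴴ * (u : Mat n) * (1 : Mat n) * (v : Mat n) * E₀ n := by
          simp only [Matrix.mul_assoc, Matrix.one_mul]
      _ = _ := by rw [← E₀_mul_conjTranspose hn]; simp only [Matrix.mul_assoc]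
  continuous_toFun := by
    refine Continuous.subtype_mk (Continuous.matrix_map ?_ Complex.continuous_re) _
    fun_prop
  continuous_invFun := by
    refine Continuous.subtype_mk (Continuous.subtype_mk ?_ _) _
    exact (continuous_const.matrix_mul (continuous_subtype_val.matrix_map
      Complex.continuous_ofReal)).matrix_mul continuous_const

theorem form_entangled (hn : 0 < n) (he : Even n) (j k : Fin (2 ^ n)) :
    form n (entangled n j) (entangled n k) = if j = k then 1 else 0 := by
  rw [entangled, entangled, form_mulVec, E₀_transpose_mul_S_mul hn he, one_mulVec,
    single_one_dotProduct, Pi.single_apply]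

theorem star_entangled_dotProduct_self (hn : 0 < n) (j : Fin (2 ^ n)) :
    star (entangled n j) ⬝ᵥ entangled n j = 1 := by
  rw [entangled, star_mulVec, ← dotProduct_mulVec, mulVec_mulVec, E₀_conjTranspose_mul_self hn,
    one_mulVec]
  simp

theorem form_sum_entangled (hn : 0 < n) (he : Even n) (a b : Fin (2 ^ n) → ℝ) :
    form n (∑ j, a j • entangled n j) (∑ j, b j • entangled n j) =
      ((∑ j, a j * b j : ℝ) : ℂ) := by
  have h : ∀ a : Fin (2 ^ n) → ℝ, ∑ j, a j • entangled n j = ∑ j, (a j : ℂ) • entangled n j :=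
    fun a => Finset.sum_congr rfl fun j _ => by ext i; simp
  simp only [h, map_sum, map_smul, LinearMap.sum_apply, LinearMap.smul_apply, smul_eq_mul,
    form_entangled hn he]
  push_cast
  refine Finset.sum_congr rfl fun j _ => ?_
  simp [mul_comm]

theorem mulVec_mem_realSpan (hn : 0 < n) (he : Even n) {u : Mat n} (hu : uᴴ * u = 1)
    (hS : uᵀ * S n * u = S n) {v : State n} (hv : v ∈ realSpan n) : u *ᵥ v ∈ realSpan n := by
  induction hv using Submodule.span_induction with
  | mem x hx =>
    obtain ⟨j, rfl⟩ := hx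
    have hM := map_re_map_ofReal (conjMat_E₀_conj hn he hu hS)
    -- `u E₀ = E₀ M` with the real matrix `M = E₀ᴴ u E₀`.
    have h : u *ᵥ entangled n j =
        ∑ k, ((E₀ n)ᴴ * u * E₀ n).map Complex.re k j • entangled n k := by
      have h1 : u * E₀ n = E₀ n * (((E₀ n)ᴴ * u * E₀ n).map Complex.re).map Complex.ofReal := by
        rw [hM, ← Matrix.mul_assoc, ← Matrix.mul_assoc, E₀_mul_conjTranspose hn, Matrix.one_mul]
      rw [entangled, mulVec_mulVec, h1]
      ext i
      simp [entangled, mul_apply, mul_comm]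
    rw [h]
    exact Submodule.sum_mem _ fun k _ => Submodule.smul_mem _ _ (Submodule.subset_span ⟨k, rfl⟩)
  | zero => rw [mulVec_zero]; exact Submodule.zero_mem _
  | add x y _ _ hx hy => rw [mulVec_add]; exact Submodule.add_mem _ hx hy
  | smul c x _ hx => rw [mulVec_smul]; exact Submodule.smul_mem _ _ hx

/-! ### An odd number of qubits -/

/-- The inclusion of the first `N / 2` labels. -/
def lowerHalf (n : ℕ) (i : Fin (2 ^ n / 2)) : Fin (2 ^ n) := Fin.castLE (Nat.div_le_self _ _) i

/-- The matrix with columns `|i⟩` and `S|i⟩`, `i < N / 2`: for `n` odd, a real orthonormal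
symplectic basis for the concurrence form. -/
noncomputable def symplecticBasis (n : ℕ) :
    Matrix (Fin (2 ^ n)) (Fin (2 ^ n / 2) ⊕ Fin (2 ^ n / 2)) ℂ :=
  fromCols (coordMat (lowerHalf n)) (S n * coordMat (lowerHalf n))

theorem conjTranspose_symplecticBasis (n : ℕ) :
    (symplecticBasis n)ᴴ = (symplecticBasis n)ᵀ := by
  have hA : (coordMat (lowerHalf n))ᴴ = (coordMat (lowerHalf n))ᵀ := by
    ext i j; simp [coordMat, one_apply, apply_ite]
  rw [symplecticBasis, conjTranspose_fromCols_eq_fromRows_conjTranspose, transpose_fromCols,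
    conjTranspose_mul, transpose_mul, hA, transpose_S_eq_conjTranspose]

theorem symplecticBasis_transpose_mul_self (hn : 0 < n) :
    (symplecticBasis n)ᵀ * symplecticBasis n = 1 := by
  have hlt : ∀ i, (lowerHalf n i : ℕ) < 2 ^ n / 2 := fun i => i.2
  have h0 := coordMat_transpose_mul_S_mul hn hlt
  have h0' := coordMat_transpose_mul_transpose_S_mul hn hlt
  have h1 : (coordMat (lowerHalf n))ᵀ * coordMat (lowerHalf n) = 1 := by
    rw [coordMat_transpose_mul_self]
    exact submatrix_one _ (Fin.castLE_injective (Nat.div_le_self _ _))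
  rw [symplecticBasis, transpose_fromCols, fromRows_mul_fromCols, transpose_mul, h0, h1,
    Matrix.mul_assoc, h0', Matrix.mul_assoc, ← Matrix.mul_assoc (S n)ᵀ, transpose_S_mul_S,
    Matrix.one_mul, h1, fromBlocks_one]

theorem symplecticBasis_mul_transpose (hn : 0 < n) :
    symplecticBasis n * (symplecticBasis n)ᵀ = 1 := by
  refine (mul_eq_one_comm_of_card_eq _ _ _ ?_).mp (symplecticBasis_transpose_mul_self hn)
  obtain ⟨m, rfl⟩ := Nat.exists_eq_succ_of_ne_zero hn.ne'
  have h4 : 2 ^ m.succ = 2 * 2 ^ m := pow_succ' 2 m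
  simp only [Fintype.card_sum, Fintype.card_fin]
  omega

theorem S_mul_symplecticBasis (ho : Odd n) :
    S n * symplecticBasis n = symplecticBasis n * J (Fin (2 ^ n / 2)) ℂ := by
  have hSS : S n * S n = -1 := by rw [S_mul_S, ho.neg_one_pow, neg_smul, one_smul]
  rw [symplecticBasis, J, fromCols_mul_fromBlocks, mul_fromCols, ← Matrix.mul_assoc, hSS]
  simp

/-- If a change of basis `W` with `Wᵀ = W⁻¹` carries the bilinear form `B` to `C`, then it carries
the symmetries of `B` to symmetries of `C`. -/
theorem transpose_mul_mul_eq_of_intertwine {ι κ : Type*} [Fintype ι] [DecidableEq ι]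
    [Fintype κ] [DecidableEq κ] {W : Matrix ι κ ℂ} {B : Matrix ι ι ℂ} {C : Matrix κ κ ℂ}
    (h1 : Wᵀ * W = 1) (h2 : W * Wᵀ = 1) (hBC : B * W = W * C) {u : Matrix ι ι ℂ}
    (hu : uᵀ * B * u = B) : (Wᵀ * u * W)ᵀ * C * (Wᵀ * u * W) = C := by
  have hB : W * C * Wᵀ = B := by rw [← hBC, Matrix.mul_assoc, h2, Matrix.mul_one]
  calc _ = Wᵀ * (uᵀ * (W * C * Wᵀ) * u) * W := by
        simp only [transpose_mul, transpose_transpose, Matrix.mul_assoc]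
    _ = C := by rw [hB, hu, Matrix.mul_assoc, hBC, ← Matrix.mul_assoc, h1, Matrix.one_mul]

/-- For `n` odd, passing to a real orthonormal symplectic basis identifies the symmetry group with
the compact symplectic group. -/
noncomputable def symmetryGroupEquivSp (hn : 0 < n) (ho : Odd n) :
    symmetryGroup n ≃ₜ* compactSp (2 ^ n / 2) where
  toFun u := ⟨⟨(symplecticBasis n)ᵀ * (u : Mat n) * symplecticBasis n, by
      rw [← conjTranspose_symplecticBasis]
      apply conjTranspose_mul_mul_mem_specialUnitaryGroup _ _ u.1.2
      · rw [conjTranspose_symplecticBasis, symplecticBasis_transpose_mul_self hn]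
      · rw [conjTranspose_symplecticBasis, symplecticBasis_mul_transpose hn]⟩,
    transpose_mul_mul_eq_of_intertwine (symplecticBasis_transpose_mul_self hn)
      (symplecticBasis_mul_transpose hn) (S_mul_symplecticBasis ho) u.2⟩
  invFun V := ⟨⟨symplecticBasis n * V.1.1 * (symplecticBasis n)ᵀ, by
      have := conjTranspose_mul_mul_mem_specialUnitaryGroup (W := (symplecticBasis n)ᴴ)
        (by rw [conjTranspose_conjTranspose, conjTranspose_symplecticBasis,
              symplecticBasis_mul_transpose hn])
        (by rw [conjTranspose_conjTranspose, conjTranspose_symplecticBasis,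
              symplecticBasis_transpose_mul_self hn]) V.1.2
      rwa [conjTranspose_conjTranspose, conjTranspose_symplecticBasis] at this⟩, by
      have h1 := symplecticBasis_transpose_mul_self hn
      have h2 := symplecticBasis_mul_transpose hn
      have := transpose_mul_mul_eq_of_intertwine (W := (symplecticBasis n)ᵀ)
        (B := J (Fin (2 ^ n / 2)) ℂ) (C := S n)
        (by rwa [transpose_transpose]) (by rwa [transpose_transpose])
        (by
          calc J (Fin (2 ^ n / 2)) ℂ * (symplecticBasis n)ᵀ
              = (symplecticBasis n)ᵀ * (symplecticBasis n * J (Fin (2 ^ n / 2)) ℂ) *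
                  (symplecticBasis n)ᵀ := by rw [← Matrix.mul_assoc, h1, Matrix.one_mul]
            _ = (symplecticBasis n)ᵀ * S n := by
                rw [← S_mul_symplecticBasis ho, Matrix.mul_assoc, Matrix.mul_assoc, h2,
                  Matrix.mul_one]) V.2
      rwa [transpose_transpose] at this⟩
  left_inv u := by
    apply Subtype.ext
    apply Subtype.ext
    change symplecticBasis n * ((symplecticBasis n)ᵀ * (u : Mat n) * symplecticBasis n) *
      (symplecticBasis n)ᵀ = (u : Mat n)
    calc _ = (symplecticBasis n * (symplecticBasis n)ᵀ) * (u : Mat n) *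
          (symplecticBasis n * (symplecticBasis n)ᵀ) := by simp only [Matrix.mul_assoc]
      _ = _ := by rw [symplecticBasis_mul_transpose hn, Matrix.one_mul, Matrix.mul_one]
  right_inv V := by
    apply Subtype.ext
    apply Subtype.ext
    change (symplecticBasis n)ᵀ * (symplecticBasis n * V.1.1 * (symplecticBasis n)ᵀ) *
      symplecticBasis n = V.1.1
    calc _ = ((symplecticBasis n)ᵀ * symplecticBasis n) * V.1.1 *
          ((symplecticBasis n)ᵀ * symplecticBasis n) := by simp only [Matrix.mul_assoc]
      _ = _ := by rw [symplecticBasis_transpose_mul_self hn, Matrix.one_mul, Matrix.mul_one]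
  map_mul' u v := by
    apply Subtype.ext
    apply Subtype.ext
    change (symplecticBasis n)ᵀ * ((u : Mat n) * (v : Mat n)) * symplecticBasis n =
      ((symplecticBasis n)ᵀ * (u : Mat n) * symplecticBasis n) *
        ((symplecticBasis n)ᵀ * (v : Mat n) * symplecticBasis n)
    calc _ = (symplecticBasis n)ᵀ * (u : Mat n) * (1 : Mat n) * (v : Mat n) * symplecticBasis n := by
          simp only [Matrix.mul_assoc, Matrix.one_mul]
      _ = _ := by rw [← symplecticBasis_mul_transpose hn]; simp only [Matrix.mul_assoc]
  continuous_toFun := by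
    refine Continuous.subtype_mk (Continuous.subtype_mk ?_ _) _
    fun_prop
  continuous_invFun := by
    refine Continuous.subtype_mk (Continuous.subtype_mk ?_ _) _
    fun_prop

end Concurrence

theorem mainTheorem1 (n : ℕ) (hn : 0 < n) :
    -- K is the symmetry group, within SU(N), of the concurrence form
    (∀ u ∈ Concurrence.K n, u ∈ Matrix.specialUnitaryGroup (Fin (2 ^ n)) ℂ) ∧
    (∀ u ∈ Matrix.specialUnitaryGroup (Fin (2 ^ n)) ℂ,
      (u ∈ Concurrence.K n ↔ ∀ φ ψ : Concurrence.State n,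
        Concurrence.form n (u *ᵥ φ) (u *ᵥ ψ) = Concurrence.form n φ ψ)) ∧
    -- the form for n even: symmetric, and the dot product on a real subspace preserved by K
    (Even n →
      (∀ φ ψ : Concurrence.State n, Concurrence.form n ψ φ = Concurrence.form n φ ψ) ∧
      (∀ j, star (Concurrence.entangled n j) ⬝ᵥ Concurrence.entangled n j = 1 ∧
        Concurrence.concurrence n (Concurrence.entangled n j) = 1) ∧
      (∀ a b : Fin (2 ^ n) → ℝ,
        Concurrence.form n (∑ j, a j • Concurrence.entangled n j)
          (∑ j, b j • Concurrence.entangled n j) = ((∑ j, a j * b j : ℝ) : ℂ)) ∧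
      (∀ u ∈ Concurrence.K n, ∀ v ∈ Concurrence.realSpan n, u *ᵥ v ∈ Concurrence.realSpan n)) ∧
    -- the form for n odd
    (Odd n →
      (∀ φ ψ : Concurrence.State n, Concurrence.form n ψ φ = -Concurrence.form n φ ψ) ∧
      (Concurrence.form n).Nondegenerate) ∧
    -- K is a subgroup of SU(N), and its isomorphism type as a topological group
    (∃ G : Subgroup (Matrix.specialUnitaryGroup (Fin (2 ^ n)) ℂ),
      (∀ u, u ∈ G ↔ (u : Concurrence.Mat n) ∈ Concurrence.K n) ∧
      (Even n →
        Concurrence.E₀ n ∈ Matrix.unitaryGroup (Fin (2 ^ n)) ℂ ∧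
        ∃ f : G ≃ₜ* Matrix.specialOrthogonalGroup (Fin (2 ^ n)) ℝ,
          ∀ u : G, ((f u : Matrix (Fin (2 ^ n)) (Fin (2 ^ n)) ℝ).map Complex.ofReal) =
            (Concurrence.E₀ n)ᴴ * (u : Concurrence.Mat n) * Concurrence.E₀ n) ∧
      (Odd n → Nonempty (G ≃ₜ* Concurrence.compactSp (2 ^ n / 2)))) := by
  open Concurrence in
  refine ⟨fun u hu => ((mem_K_iff u).mp hu).1, fun u hu => ?_, fun he => ⟨fun φ ψ => ?_,
    fun j => ⟨star_entangled_dotProduct_self hn j, ?_⟩, form_sum_entangled hn he,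
    fun u hu v hv => ?_⟩, fun ho => ⟨fun φ ψ => ?_, form_nondegenerate n⟩,
    symmetryGroup n, fun u => ?_, fun he => ⟨?_, symmetryGroupEquivSO hn he,
      map_re_E₀_conj hn he⟩, fun ho => ⟨symmetryGroupEquivSp hn ho⟩⟩
  · rw [mem_K_iff, form_invariant_iff]
    exact and_iff_right hu
  · rw [form_swap, he.neg_one_pow, one_mul]
  · rw [concurrence, form_entangled hn he, if_pos rfl, norm_one]
  · obtain ⟨hu, hS⟩ := (mem_K_iff u).mp hu
    exact mulVec_mem_realSpan hn he (conjTranspose_mul_self_of_mem hu) hS hv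
  · rw [form_swap, ho.neg_one_pow, neg_one_mul]
  · rw [mem_symmetryGroup, mem_K_iff]
    exact (and_iff_right u.2).symm
  · exact Matrix.mem_unitaryGroup_iff'.mpr (E₀_conjTranspose_mul_self hn)
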